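/- **Setting.** Let $k$ be a field with $\operatorname{char} k\ne 2$ and let $q\in k^\times$ with $q^2\neq -1$. Let $SU_q(2)$ be the Hopf algebra over $k$ with generators $\alpha,\beta,\gamma,\delta$ and relations $\alpha\beta=q\beta\alpha$, $\alpha\gamma=q\gamma\alpha$, $\alpha\delta=\delta\alpha+(q-q^{-1})\beta\gamma$, $\beta\gamma=\gamma\beta$, $\beta\delta=q\delta\beta$, $\gamma\delta=q\delta\gamma$, $\alpha\delta-q\beta\gamma=1$, with matrix coproduct and counit, and $S(\alpha)=\delta$, $S(\beta)=-q^{-1}\beta$, $S(\gamma)=-q\gamma$, $S(\delta)=\alpha$. Let $P=SO_q(3)\subset SU_q(2)$ be the sub-Hopf algebra generated by products of two generators, $A=k[Z,Z^{-1}]$ with $\Delta Z=Z\otimes Z$, and $\pi:P\to A$ the restriction of $\alpha\mapsto Z^{1/2}$, $\delta\mapsto Z^{-1/2}$, $\beta,\gamma\mapsto 0$. Then $A$ coacts on $P$ by $\Delta_R=(\mathrm{id}\otimes\pi)\Delta$; let $B=\{b\in P:\Delta_R b=b\otimes1\}$ (the Podleś sphere). For an algebra $H$ let $H^2=\ker(\cdot:H\otimes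 H\to H)$ with $du=1\otimes u-u\otimes 1$. Woronowicz's 3D calculus on $SU_q(2)$ is $\Gamma=SU_q(2)^2/\kappa(SU_q(2)\otimes M)$, with $\kappa(a\otimes b)=\sum aS(b_{(1)})\otimes b_{(2)}$ and $M$ the right ideal generated by $\delta+q^2\alpha-(1+q^2)$, $\gamma^2$, $\beta\gamma$, $\beta^2$, $(\alpha-1)\gamma$, $(\alpha-1)\beta$. Let $\Gamma_P=P^2/N_P\subset\Gamma$ be the inherited calculus on $P$, where $N_P=P^2\cap\kappa(SU_q(2)\otimes M)$, and let $M_P=M\cap P$, $M_A=\pi(M_P)\subset\ker\epsilon$, $\pi_A:\ker\epsilon\to\ker\epsilon/M_A$ the projection. **Connection 1-forms.** Let $\widetilde{\ }:\Gamma_P\to P\otimes\ker\epsilon/M_A$ be the map induced by $u\otimes v\mapsto u\,\Delta_R(v)$, and $\Gamma_{hor}=P(dB)P$. The data form a quantum principal bundle: $\Delta_R$ makes $P$ a comodule algebra, $P\otimes P\to P\otimes A$, $u\otimes v\mapsto u\Delta_R(v)$, is surjective, $M_A$ is a right ideal of $A$ contained in $\ker\epsilon$ and invariant under the right adjoint coaction,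 $N_P$ is a sub-bimodule with $\Delta_R N_P\subset N_P\otimes A$ and $\widetilde{\ }(N_P)\subset P\otimes M_A$, and $\ker\widetilde{\ }=\Gamma_{hor}$. A connection is a left $P$-linear projection $\Pi:\Gamma_P\to\Gamma_P$ with kernel $\Gamma_{hor}$ and $\Delta_R\Pi=(\Pi\otimes\mathrm{id})\Delta_R$. A linear map $\omega:A\to\Gamma_P$ is a connection 1-form if there are a connection $\Pi$ and a left $P$-linear $\sigma:P\otimes\ker\epsilon/M_A\to\Gamma_P$ with $\widetilde{\ }\circ\sigma=\mathrm{id}$, $\sigma\circ\widetilde{\ }=\Pi$ and $\omega(a)=\sigma(1\otimes\pi_A(a-\epsilon(a)))$ for all $a\in A$. **The canonical map.** Let $J=\ker(SU_q(2)\to k[Z^{\pm1/2}])$. In the $J$-adic completion $\varprojlim SU_q(2)/J^n$ the elements $\alpha,\delta$ are invertible; let $P_0=SO_q(3)[\delta^{-1}\alpha,\alpha^{-1}\delta]$ be the subalgebra generated there by (the image of) $SO_q(3)$ and these two elements, and $i:A\to P_0$ the algebra map with $i(Z)=\delta^{-1}\alpha$. Put $$\omega(a)=\sum S\,i(a)_{(1)}\,d\,i(a)_{(2)},$$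 where $i(a)$ and its coproduct are formal power series and the formula is understood by $J$-adic continuity: $\omega(a)$ is the common value of $\sum S(u_{(1)})\,du_{(2)}\in\Gamma_P$ on all $u\in SO_q(3)$ with $u\equiv i(a)$ modulo $J^n$, for $n$ sufficiently large. **Proposition.** This formula gives a unique well-defined linear map $\omega:A\to\Gamma_P$. The data above form a quantum principal bundle, and $\omega$ is a connection 1-form on it. Explicitly, for every Laurent polynomial $f\in A$, $$\omega(f(Z))=[2]_{q^{-2}}\;D_{q^{-4}}f(Z)\big|_{Z=1}\;\omega^1,\qquad \omega^1=\delta\,d\alpha-q^{-1}\beta\,d\gamma\in\Gamma,$$ where $[n]_x=\frac{x^n-1}{x-1}$ and $D_xf(Z)=\frac{f(xZ)-f(Z)}{(x-1)Z}$ (at $x=1$: $[n]_1=n$ and $D_1$ is the ordinary derivative). -/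

import Mathlib

open scoped TensorProduct

noncomputable section

namespace QuantumBundle

section FirstOrderCalculus

variable (k : Type*) [Field k] (P : Type*) [Ring P] [Algebra k P]

/-- The universal 1-forms `P² = ker (· : P ⊗ P → P)`, a left `P`-submodule of `P ⊗ P`. -/
def universalForms : Submodule P (P ⊗[k] P) where
  carrier := {x | LinearMap.mul' k P x = 0}
  add_mem' := by
    intro a b ha hb
    simp only [Set.mem_ofPred_eq, map_add] at *
    rw [ha, hb, add_zero]
  zero_mem' := by simp
  smul_mem' := by
    intro c x hx
    have key : ∀ y : P ⊗[k] P, LinearMap.mul' k P (c • y) = c * LinearMap.mul' k P y := by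
      intro y
      induction y with
      | zero => simp
      | tmul a b => simp [TensorProduct.smul_tmul', mul_assoc]
      | add a b ha hb => rw [smul_add, map_add, ha, hb, map_add, mul_add]
    simp only [Set.mem_ofPred_eq] at *
    rw [key, hx, mul_zero]

/-- The left `P`-linear map `P ⊗ P → P²`, `u ⊗ v ↦ u dv = u ⊗ v - u v ⊗ 1`.
It is the identity on `P²`. -/
def formOf : P ⊗[k] P →ₗ[P] universalForms k P where
  toFun x := ⟨x - LinearMap.mul' k P x ⊗ₜ[k] (1 : P), by
    change LinearMap.mul' k P _ = 0
    simp⟩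
  map_add' x y := by
    ext1
    simp only [map_add, TensorProduct.add_tmul, Submodule.coe_add]
    abel
  map_smul' c x := by
    have key : ∀ y : P ⊗[k] P, LinearMap.mul' k P (c • y) = c * LinearMap.mul' k P y := by
      intro y
      induction y with
      | zero => simp
      | tmul a b => simp [TensorProduct.smul_tmul', mul_assoc]
      | add a b ha hb => rw [smul_add, map_add, ha, hb, map_add, mul_add]
    ext1
    simp only [key, RingHom.id_apply, Submodule.coe_smul, smul_sub,
      TensorProduct.smul_tmul', smul_eq_mul]

/-- The universal differential `du = 1 ⊗ u - u ⊗ 1`. -/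
def univD : P →ₗ[k] universalForms k P :=
  (formOf k P).restrictScalars k ∘ₗ TensorProduct.mk k P P 1

variable {k P}

/-- The right `P`-action on `P²`: `(Σ a ⊗ b) c = Σ a ⊗ b c`. -/
def formMul (c : P) : universalForms k P →ₗ[P] universalForms k P where
  toFun x := ⟨(x : P ⊗[k] P) * (1 ⊗ₜ[k] c), by
    have key : ∀ y : P ⊗[k] P,
        LinearMap.mul' k P (y * (1 ⊗ₜ[k] c)) = LinearMap.mul' k P y * c := by
      intro y
      induction y with
      | zero => simp
      | tmul a b => simp [mul_assoc]
      | add a b ha hb => rw [add_mul, map_add, ha, hb, map_add, add_mul]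
    have hx : LinearMap.mul' k P (x : P ⊗[k] P) = 0 := x.2
    change LinearMap.mul' k P _ = 0
    rw [key, hx, zero_mul]⟩
  map_add' x y := by
    ext1
    simp [add_mul]
  map_smul' c x := by
    ext1
    simp [smul_mul_assoc]

/-- The space of 1-forms `Γ_P = P² / N` of the first order calculus given by `N ⊆ P²`. -/
abbrev Forms (N : Submodule P (universalForms k P)) : Type _ := universalForms k P ⧸ N

/-- The differential `d : P → Γ_P` of the calculus `P² / N`. -/
def diff (N : Submodule P (universalForms k P)) : P →ₗ[k] Forms N :=
  N.mkQ.restrictScalars k ∘ₗ univD k P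

variable {H : Type*} [Ring H] [Algebra k H]

/-- The map on universal 1-forms induced by an algebra map. -/
def mapUniv (φ : P →ₐ[k] H) : universalForms k P →ₗ[k] universalForms k H :=
  LinearMap.restrict (p := (universalForms k P).restrictScalars k)
    (q := (universalForms k H).restrictScalars k)
    (TensorProduct.map φ.toLinearMap φ.toLinearMap) (by
    have key : ∀ y : P ⊗[k] P, LinearMap.mul' k H
        (TensorProduct.map φ.toLinearMap φ.toLinearMap y) = φ (LinearMap.mul' k P y) := by
      intro y
      induction y with
      | zero => simp
      | tmul a b => simp
      | add a b ha hb => rw [map_add, map_add, ha, hb, map_add, map_add]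
    intro x hx
    have hx' : LinearMap.mul' k P x = 0 := hx
    change LinearMap.mul' k H _ = 0
    rw [key, hx', map_zero])

/-- For an algebra map `φ : P → H` and a calculus `H² / N` on `H`, the calculus on `P`
inherited from it, given by the forms in `P²` that vanish in `H² / N`. -/
def inherited (φ : P →ₐ[k] H) (N : Submodule H (universalForms k H)) :
    Submodule P (universalForms k P) where
  carrier := {ρ | mapUniv φ ρ ∈ N}
  add_mem' := by
    intro a b ha hb
    simp only [Set.mem_ofPred_eq, map_add] at *
    exact N.add_mem ha hb
  zero_mem' := by simp
  smul_mem' := by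
    intro c x hx
    have key : mapUniv φ (c • x) = φ c • mapUniv φ x := by
      have h2 : ∀ y : P ⊗[k] P, TensorProduct.map φ.toLinearMap φ.toLinearMap (c • y) =
          φ c • TensorProduct.map φ.toLinearMap φ.toLinearMap y := by
        intro y
        induction y with
        | zero => simp
        | tmul a b => simp [TensorProduct.smul_tmul']
        | add a b ha hb => rw [smul_add, map_add, ha, hb, map_add, smul_add]
      ext1
      exact h2 x
    simp only [Set.mem_ofPred_eq] at *
    rw [key]
    exact N.smul_mem _ hx

/-- The inclusion of the inherited calculus into the given one, `u dv ↦ φ(u) dφ(v)`. -/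
def formsMap (φ : P →ₐ[k] H) (N : Submodule H (universalForms k H)) :
    Forms (inherited φ N) →ₗ[k] Forms N :=
  ((inherited φ N).restrictScalars k).mapQ (N.restrictScalars k) (mapUniv φ) (fun _ hx => hx)

theorem formsMap_injective (φ : P →ₐ[k] H) (N : Submodule H (universalForms k H)) :
    Function.Injective (formsMap φ N) := by
  rw [injective_iff_map_eq_zero]
  intro x hx
  obtain ⟨y, rfl⟩ := Submodule.Quotient.mk_surjective _ x
  have h1 : (N.restrictScalars k).mkQ (mapUniv φ y) = 0 := hx
  rw [Submodule.mkQ_apply, Submodule.Quotient.mk_eq_zero] at h1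
  exact (Submodule.Quotient.mk_eq_zero _).2 h1

end FirstOrderCalculus

section LeftCovariant

variable {k : Type*} [Field k] {P : Type*} [Ring P] [HopfAlgebra k P]

variable (k P) in
/-- `κ : P ⊗ P → P ⊗ P`, `κ (a ⊗ b) = Σ a S(b₍₁₎) ⊗ b₍₂₎`. -/
def kappa : P ⊗[k] P →ₗ[P] P ⊗[k] P :=
  TensorProduct.AlgebraTensorModule.lift
    ((LinearMap.toSpanSingleton P (P →ₗ[k] P ⊗[k] P)
      ((HopfAlgebra.antipode k (A := P)).rTensor P ∘ₗ Coalgebra.comul)))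

theorem kappa_tmul (a b : P) : kappa k P (a ⊗ₜ b) =
   a • (HopfAlgebra.antipode k (A := P)).rTensor P (Coalgebra.comul (R := k) b) := by
  simp [kappa]

/-- The sub-bimodule `N = κ (P ⊗ M)` of `P²`. -/
def leftCovariant (M : Submodule k P) : Submodule P (universalForms k P) :=
  ((M.baseChange P).map (kappa k P)).comap (universalForms k P).subtype

/-- The map `·(S ⊗ d) : P ⊗ P → Γ_P`, `u ⊗ v ↦ S(u) dv`. -/
def antipodeD (N : Submodule P (universalForms k P)) : P ⊗[k] P →ₗ[k] Forms N :=
  TensorProduct.lift (((Algebra.lsmul k k (Forms N)).toLinearMap ∘ₗ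
    HopfAlgebra.antipode k (A := P)).compl₂ (diff N))

theorem antipodeD_tmul (N : Submodule P (universalForms k P)) (u v : P) :
    antipodeD N (u ⊗ₜ v) = HopfAlgebra.antipode k u • diff N v := by
  simp [antipodeD]

/-- `u ↦ Σ S(u₍₁₎) d u₍₂₎`, the composite `·(S ⊗ d) Δ`. -/
def maurerCartan (N : Submodule P (universalForms k P)) : P →ₗ[k] Forms N :=
  antipodeD N ∘ₗ Coalgebra.comul

end LeftCovariant

section HopfAlgebraCalculus

variable {k : Type*} [Field k] {A : Type*} [Ring A] [HopfAlgebra k A]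

variable (k A) in
/-- The right adjoint coaction `a ↦ Σ a₍₂₎ ⊗ S(a₍₁₎) a₍₃₎`. -/
def adR : A →ₗ[k] A ⊗[k] A :=
  (LinearMap.mul' k A ∘ₗ (HopfAlgebra.antipode k (A := A)).rTensor A).lTensor A ∘ₗ
    (TensorProduct.leftComm k A A A).toLinearMap ∘ₗ
    (Coalgebra.comul (R := k) (A := A)).lTensor A ∘ₗ Coalgebra.comul

variable (k A) in
/-- `ker ε`. -/
def augmentation : Submodule k A := LinearMap.ker (Coalgebra.counit (R := k) (A := A))

variable (k A) in
/-- The projection `A → ker ε`, `a ↦ a - ε(a)`. -/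
def toAugmentation : A →ₗ[k] augmentation k A :=
  (LinearMap.id - Algebra.linearMap k A ∘ₗ Coalgebra.counit).codRestrict _ (by
    intro a
    simp [augmentation])

/-- `ker ε / M_A`. -/
abbrev InvForms (M : Submodule k A) : Type _ :=
  augmentation k A ⧸ M.comap (augmentation k A).subtype

/-- `a ↦ π_A (a - ε(a))` with `π_A : ker ε → ker ε / M_A` the canonical projection. -/
def piA (M : Submodule k A) : A →ₗ[k] InvForms M :=
  (M.comap (augmentation k A).subtype).mkQ ∘ₗ toAugmentation k A

variable (k) in
/-- `M` is a right ideal of `A` contained in `ker ε` and invariant under the right adjoint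
coaction, so that it defines a bicovariant first order calculus on `A`. -/
structure IsBicovariantIdeal (M : Submodule k A) : Prop where
  le_augmentation : M ≤ augmentation k A
  mul_mem : ∀ a ∈ M, ∀ b : A, a * b ∈ M
  adR_mem : ∀ a ∈ M, adR k A a ∈ LinearMap.range (M.subtype.rTensor A)

end HopfAlgebraCalculus

section Bundle

variable {k : Type*} [Field k] {P : Type*} [Ring P] [Algebra k P]
  {A : Type*} [Ring A] [HopfAlgebra k A]

/-- The diagonal coaction `u ⊗ v ↦ Σ u⁽¹⁾ ⊗ v⁽¹⁾ ⊗ u⁽²⁾ v⁽²⁾` on `P ⊗ P`. -/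
def coactTensor (Δ : P →ₐ[k] P ⊗[k] A) : P ⊗[k] P →ₗ[k] (P ⊗[k] P) ⊗[k] A :=
  (LinearMap.mul' k A).lTensor (P ⊗[k] P) ∘ₗ
    (TensorProduct.tensorTensorTensorComm k P A P A).toLinearMap ∘ₗ
    TensorProduct.map Δ.toLinearMap Δ.toLinearMap

/-- The coaction on universal 1-forms,
`Δ_R (u dv) = Σ u⁽¹⁾ dv⁽¹⁾ ⊗ u⁽²⁾ v⁽²⁾`. -/
def coactUniv (Δ : P →ₐ[k] P ⊗[k] A) :
    universalForms k P →ₗ[k] universalForms k P ⊗[k] A :=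
  ((formOf k P).restrictScalars k).rTensor A ∘ₗ coactTensor Δ ∘ₗ
    (universalForms k P).subtype.restrictScalars k

/-- The left `P`-linear map `P ⊗ P → P ⊗ A`, `u ⊗ v ↦ u Δ_R(v)`. -/
def canonicalMap (Δ : P →ₐ[k] P ⊗[k] A) : P ⊗[k] P →ₗ[P] P ⊗[k] A :=
  TensorProduct.AlgebraTensorModule.lift
    (LinearMap.toSpanSingleton P (P →ₗ[k] P ⊗[k] A) Δ.toLinearMap)

theorem canonicalMap_tmul (Δ : P →ₐ[k] P ⊗[k] A) (u v : P) :
    canonicalMap Δ (u ⊗ₜ v) = u • Δ v := by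
  simp [canonicalMap]

/-- The map generating the fundamental vector fields, `P² → P ⊗ A`, the restriction of
`(· ⊗ id)(id ⊗ Δ_R)`. -/
def tilde (Δ : P →ₐ[k] P ⊗[k] A) : universalForms k P →ₗ[P] P ⊗[k] A :=
  canonicalMap Δ ∘ₗ (universalForms k P).subtype

variable (Δ : P →ₐ[k] P ⊗[k] A) (N : Submodule P (universalForms k P)) (M : Submodule k A)

/-- Horizontal forms `P (dB) P ⊆ Γ_P`, with `B = {b | Δ_R b = b ⊗ 1}`. -/
def horizontal : Submodule P (Forms N) :=
  Submodule.span P {ρ | ∃ b v : P, Δ b = b ⊗ₜ 1 ∧ ρ = N.mkQ (formMul v (univD k P b))}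

variable {Δ N M}

/-- The map `Γ_P → P ⊗ ker ε / M_A` induced by `tilde`. -/
def tildeN (hM : M ≤ augmentation k A)
    (h : ∀ ρ ∈ N, tilde Δ ρ ∈ LinearMap.range (M.subtype.lTensor P)) :
    Forms N →ₗ[P] P ⊗[k] InvForms M :=
  N.liftQ ((piA M).baseChange P ∘ₗ tilde Δ) (by
    intro ρ hρ
    obtain ⟨x, hx⟩ := h ρ hρ
    have h0 : piA M ∘ₗ M.subtype = 0 := by
      ext y
      have hy : Coalgebra.counit (R := k) (y : A) = 0 := hM y.2
      refine (Submodule.Quotient.mk_eq_zero _).2 ?_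
      change (y : A) - algebraMap k A (Coalgebra.counit (R := k) (y : A)) ∈ M
      rw [hy, map_zero, sub_zero]
      exact y.2
    have h1 : (piA M).lTensor P (M.subtype.lTensor P x) = 0 := by
      rw [← LinearMap.comp_apply, ← LinearMap.lTensor_comp, h0]
      simp
    rw [LinearMap.mem_ker, LinearMap.comp_apply, ← hx]
    exact h1)

/-- The coaction `Γ_P → Γ_P ⊗ A` induced by the coaction on universal 1-forms. -/
def coactForms (h : ∀ ρ ∈ N, coactUniv Δ ρ ∈
      LinearMap.range ((N.subtype.restrictScalars k).rTensor A)) :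
    Forms N →ₗ[k] Forms N ⊗[k] A :=
  (N.restrictScalars k).liftQ ((N.mkQ.restrictScalars k).rTensor A ∘ₗ coactUniv Δ) (by
    intro ρ hρ
    obtain ⟨x, hx⟩ := h ρ hρ
    rw [LinearMap.mem_ker, LinearMap.comp_apply, ← hx, ← LinearMap.comp_apply,
      ← LinearMap.rTensor_comp]
    have : N.mkQ.restrictScalars k ∘ₗ N.subtype.restrictScalars k = 0 := by
      ext y
      simp
    rw [this]
    simp)

variable (Δ N M)

/-- `P(B, A, N, M_A)` is a quantum principal bundle with base `B = {b | Δ_R b = b ⊗ 1}`,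
structure quantum group `A` and differential calculi given by `N` and `M_A`. -/
structure IsQuantumPrincipalBundle : Prop where
  coassoc : (TensorProduct.assoc k P A A).toLinearMap ∘ₗ Δ.toLinearMap.rTensor A ∘ₗ
    Δ.toLinearMap = (Coalgebra.comul (R := k) (A := A)).lTensor P ∘ₗ Δ.toLinearMap
  counit : ∀ u : P, (Coalgebra.counit (R := k) (A := A)).lTensor P (Δ u) = u ⊗ₜ 1
  mul_mem : ∀ ρ ∈ N, ∀ c : P, formMul c ρ ∈ N
  bicovariant : IsBicovariantIdeal k M
  free : Function.Surjective (canonicalMap Δ)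
  covariant : ∀ ρ ∈ N, coactUniv Δ ρ ∈ LinearMap.range ((N.subtype.restrictScalars k).rTensor A)
  fundamental : ∀ ρ ∈ N, tilde Δ ρ ∈ LinearMap.range (M.subtype.lTensor P)
  exact : LinearMap.ker (tildeN bicovariant.le_augmentation fundamental) = horizontal Δ N

variable {Δ N M}

/-- The map `Γ_P → P ⊗ ker ε / M_A` of a quantum principal bundle. -/
abbrev IsQuantumPrincipalBundle.tildeN (h : IsQuantumPrincipalBundle Δ N M) :
    Forms N →ₗ[P] P ⊗[k] InvForms M :=
  QuantumBundle.tildeN h.bicovariant.le_augmentation h.fundamental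

/-- A connection, given by the projection `Π` of `Γ_P` onto the vertical forms: a left
`P`-linear projection with kernel `Γ_hor` that is right invariant,
`Δ_R Π = (Π ⊗ id) Δ_R`. -/
structure IsConnection (h : IsQuantumPrincipalBundle Δ N M) (Pr : Forms N →ₗ[P] Forms N) :
    Prop where
  idem : Pr ∘ₗ Pr = Pr
  ker_eq : LinearMap.ker Pr = horizontal Δ N
  equivariant : coactForms h.covariant ∘ₗ Pr.restrictScalars k =
    (Pr.restrictScalars k).rTensor A ∘ₗ coactForms h.covariant

/-- `ω` is a connection 1-form: there are a connection `Π` and the corresponding splitting `σ`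
of `Γ_P → P ⊗ ker ε / M_A`, so that `Π = σ ∘ tilde`, with
`ω(a) = σ (1 ⊗ π_A (a - ε(a)))`. -/
def IsConnectionForm (h : IsQuantumPrincipalBundle Δ N M) (ω : A →ₗ[k] Forms N) : Prop :=
  ∃ (Pr : Forms N →ₗ[P] Forms N) (σ : P ⊗[k] InvForms M →ₗ[P] Forms N),
    IsConnection h Pr ∧ h.tildeN ∘ₗ σ = LinearMap.id ∧
      σ ∘ₗ h.tildeN = Pr ∧ ∀ a : A, ω a = σ (1 ⊗ₜ piA M a)

end Bundle

section SubHopf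

variable {k : Type*} [Field k] {H : Type*} [Ring H] [HopfAlgebra k H]

/-- A subalgebra `U` of a Hopf algebra with `Δ(U) ⊆ U ⊗ U` and `S(U) ⊆ U`. -/
structure IsHopfSubalgebra (U : Subalgebra k H) : Prop where
  comul_mem : ∀ x ∈ U, Coalgebra.comul (R := k) x ∈
    (Algebra.TensorProduct.map U.val U.val).range
  antipode_mem : ∀ x ∈ U, HopfAlgebra.antipode k x ∈ U

theorem tensor_val_injective (U : Subalgebra k H) :
    Function.Injective (Algebra.TensorProduct.map U.val U.val) := by
  have := TensorProduct.map_injective_of_flat_flat U.val.toLinearMap U.val.toLinearMap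
    Subtype.val_injective Subtype.val_injective
  exact this

/-- The restriction of `Δ` to a Hopf subalgebra. -/
def subComul (U : Subalgebra k H) (hU : IsHopfSubalgebra U) : U →ₐ[k] U ⊗[k] U :=
  (AlgEquiv.ofInjective _ (tensor_val_injective U)).symm.toAlgHom.comp
    (((Bialgebra.comulAlgHom k H).comp U.val).codRestrict _ (fun x => hU.comul_mem x x.2))

theorem map_subComul (U : Subalgebra k H) (hU : IsHopfSubalgebra U) (x : U) :
    Algebra.TensorProduct.map U.val U.val (subComul U hU x) =
      Coalgebra.comul (R := k) (x : H) := by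
  have := AlgEquiv.apply_symm_apply (AlgEquiv.ofInjective _ (tensor_val_injective U))
    (((Bialgebra.comulAlgHom k H).comp U.val).codRestrict _ (fun x => hU.comul_mem x x.2) x)
  exact congrArg Subtype.val this


theorem subComul_coassoc (U : Subalgebra k H) (hU : IsHopfSubalgebra U) :
    (Algebra.TensorProduct.assoc k k k U U U).toAlgHom.comp
      ((Algebra.TensorProduct.map (subComul U hU) (.id k U)).comp (subComul U hU)) =
    (Algebra.TensorProduct.map (.id k U) (subComul U hU)).comp (subComul U hU) := by
  have inj : Function.Injective (Algebra.TensorProduct.map U.val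
      (Algebra.TensorProduct.map U.val U.val)) := by
    have := TensorProduct.map_injective_of_flat_flat U.val.toLinearMap
      (Algebra.TensorProduct.map U.val U.val).toLinearMap
      Subtype.val_injective (tensor_val_injective U)
    exact this
  have h1 : ∀ t : U ⊗[k] U, Algebra.TensorProduct.map U.val
      (Algebra.TensorProduct.map U.val U.val)
      (Algebra.TensorProduct.assoc k k k U U U
        (Algebra.TensorProduct.map (subComul U hU) (.id k U) t)) =
      Algebra.TensorProduct.assoc k k k H H H
        (Algebra.TensorProduct.map (Bialgebra.comulAlgHom k H) (.id k H)
          (Algebra.TensorProduct.map U.val U.val t)) := by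
    intro t
    induction t with
    | zero => simp
    | add a b ha hb => simp only [map_add, ha, hb]
    | tmul a b =>
      have h2 : ∀ (s : U ⊗[k] U) (c : U), Algebra.TensorProduct.map U.val
          (Algebra.TensorProduct.map U.val U.val)
          (Algebra.TensorProduct.assoc k k k U U U (s ⊗ₜ c)) =
          Algebra.TensorProduct.assoc k k k H H H
            ((Algebra.TensorProduct.map U.val U.val s) ⊗ₜ (c : H)) := by
        intro s c
        induction s with
        | zero => simp
        | add a b ha hb => simp only [map_add, TensorProduct.add_tmul, ha, hb]
        | tmul a b => simp
      simp only [Algebra.TensorProduct.map_tmul, AlgHom.id_apply, h2, map_subComul]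
      rfl
  have h3 : ∀ t : U ⊗[k] U, Algebra.TensorProduct.map U.val
      (Algebra.TensorProduct.map U.val U.val)
      (Algebra.TensorProduct.map (.id k U) (subComul U hU) t) =
        (Algebra.TensorProduct.map (.id k H) (Bialgebra.comulAlgHom k H)
          (Algebra.TensorProduct.map U.val U.val t)) := by
    intro t
    induction t with
    | zero => simp
    | add a b ha hb => simp only [map_add, ha, hb]
    | tmul a b =>
      simp only [Algebra.TensorProduct.map_tmul, AlgHom.id_apply, map_subComul]
      rfl
  ext x
  apply inj
  refine (h1 _).trans (Eq.trans ?_ (h3 _).symm)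
  rw [AlgHom.coe_toRingHom, map_subComul]
  exact Coalgebra.coassoc_apply (R := k) (x : H)

theorem subComul_counit_left (U : Subalgebra k H) (hU : IsHopfSubalgebra U) :
    (Algebra.TensorProduct.map ((Bialgebra.counitAlgHom k H).comp U.val) (.id k U)).comp
      (subComul U hU) = (Algebra.TensorProduct.lid k U).symm := by
  have h : ∀ t : U ⊗[k] U, ((Algebra.TensorProduct.lid k U
      (Algebra.TensorProduct.map ((Bialgebra.counitAlgHom k H).comp U.val) (.id k U) t) : U) : H) =
      Algebra.TensorProduct.lid k H ((Coalgebra.counit (R := k) (A := H)).rTensor H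
        (Algebra.TensorProduct.map U.val U.val t)) := by
    intro t
    induction t with
    | zero => simp
    | add a b ha hb => simp only [map_add, Subalgebra.coe_add, ha, hb]
    | tmul a b => simp
  ext x
  apply (Algebra.TensorProduct.lid k U).injective
  apply Subtype.val_injective
  refine (h _).trans ?_
  rw [AlgHom.coe_toRingHom, map_subComul]
  simp

theorem subComul_counit_right (U : Subalgebra k H) (hU : IsHopfSubalgebra U) :
    (Algebra.TensorProduct.map (.id k U) ((Bialgebra.counitAlgHom k H).comp U.val)).comp
      (subComul U hU) = (Algebra.TensorProduct.rid k k U).symm := by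
  have h : ∀ t : U ⊗[k] U, ((Algebra.TensorProduct.rid k k U
      (Algebra.TensorProduct.map (.id k U) ((Bialgebra.counitAlgHom k H).comp U.val) t) : U) : H) =
      Algebra.TensorProduct.rid k k H ((Coalgebra.counit (R := k) (A := H)).lTensor H
        (Algebra.TensorProduct.map U.val U.val t)) := by
    intro t
    induction t with
    | zero => simp
    | add a b ha hb => simp only [map_add, Subalgebra.coe_add, ha, hb]
    | tmul a b => simp
  ext x
  apply (Algebra.TensorProduct.rid k k U).injective
  apply Subtype.val_injective
  refine (h _).trans ?_
  rw [AlgHom.coe_toRingHom, map_subComul]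
  simp

/-- The restriction of the antipode to a Hopf subalgebra. -/
def subAntipode (U : Subalgebra k H) (hU : IsHopfSubalgebra U) : U →ₗ[k] U :=
  (HopfAlgebra.antipode k (A := H)).restrict
    (p := Subalgebra.toSubmodule U) (q := Subalgebra.toSubmodule U) hU.antipode_mem

theorem subAntipode_coe (U : Subalgebra k H) (hU : IsHopfSubalgebra U) (x : U) :
    (subAntipode U hU x : H) = HopfAlgebra.antipode k (x : H) := rfl

/-- A Hopf subalgebra is a Hopf algebra with the restricted structure maps. -/
@[reducible]
def subHopfAlgebra (U : Subalgebra k H) (hU : IsHopfSubalgebra U) : HopfAlgebra k U :=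
  letI : Bialgebra k U := Bialgebra.ofAlgHom (subComul U hU)
    ((Bialgebra.counitAlgHom k H).comp U.val) (subComul_coassoc U hU)
    (subComul_counit_left U hU) (subComul_counit_right U hU)
  { antipode := subAntipode U hU
    mul_antipode_rTensor_comul := by
      have h : ∀ t : U ⊗[k] U,
          ((LinearMap.mul' k U ((subAntipode U hU).rTensor U t) : U) : H) =
          LinearMap.mul' k H ((HopfAlgebra.antipode k (A := H)).rTensor H
            (Algebra.TensorProduct.map U.val U.val t)) := by
        intro t
        induction t with
        | zero => simp
        | add a b ha hb => simp only [map_add, Subalgebra.coe_add, ha, hb]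
        | tmul a b => simp [subAntipode_coe]
      ext x
      refine (h (subComul U hU x)).trans ?_
      rw [map_subComul, HopfAlgebra.mul_antipode_rTensor_comul_apply]
      rfl
    mul_antipode_lTensor_comul := by
      have h : ∀ t : U ⊗[k] U,
          ((LinearMap.mul' k U ((subAntipode U hU).lTensor U t) : U) : H) =
          LinearMap.mul' k H ((HopfAlgebra.antipode k (A := H)).lTensor H
            (Algebra.TensorProduct.map U.val U.val t)) := by
        intro t
        induction t with
        | zero => simp
        | add a b ha hb => simp only [map_add, Subalgebra.coe_add, ha, hb]
        | tmul a b => simp [subAntipode_coe]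
      ext x
      refine (h (subComul U hU x)).trans ?_
      rw [map_subComul, HopfAlgebra.mul_antipode_lTensor_comul_apply]
      rfl }

end SubHopf

/-! ### The quantum group `SU_q(2)` -/

section SUq2

/-- The four generators `α, β, γ, δ`. -/
inductive Gen : Type
  | a | b | c | d

variable {k : Type*} [Field k] (q : kˣ)

/-- The defining relations of `SU_q(2)`. -/
inductive SURel : FreeAlgebra k Gen → FreeAlgebra k Gen → Prop
  | ab : SURel (.ι k .a * .ι k .b) ((q : k) • (.ι k .b * .ι k .a))
  | ac : SURel (.ι k .a * .ι k .c) ((q : k) • (.ι k .c * .ι k .a))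
  | ad : SURel (.ι k .a * .ι k .d)
      (.ι k .d * .ι k .a + ((q : k) - (q : k)⁻¹) • (.ι k .b * .ι k .c))
  | bc : SURel (.ι k .b * .ι k .c) (.ι k .c * .ι k .b)
  | bd : SURel (.ι k .b * .ι k .d) ((q : k) • (.ι k .d * .ι k .b))
  | cd : SURel (.ι k .c * .ι k .d) ((q : k) • (.ι k .d * .ι k .c))
  | det : SURel (.ι k .a * .ι k .d - (q : k) • (.ι k .b * .ι k .c)) 1

/-- The algebra `SU_q(2)`. -/
def SUq2 : Type _ := RingQuot (SURel q)

instance : Ring (SUq2 q) := inferInstanceAs (Ring (RingQuot (SURel q)))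

instance : Algebra k (SUq2 q) := inferInstanceAs (Algebra k (RingQuot (SURel q)))

/-- The quotient map from the free algebra. -/
def suMk : FreeAlgebra k Gen →ₐ[k] SUq2 q := RingQuot.mkAlgHom k (SURel q)

theorem suMk_rel {x y : FreeAlgebra k Gen} (h : SURel q x y) : suMk q x = suMk q y :=
  RingQuot.mkAlgHom_rel k h

/-- A generator of `SU_q(2)`. -/
def gen (i : Gen) : SUq2 q := suMk q (FreeAlgebra.ι k i)

/-- The relations of `SU_q(2)` for four elements of an algebra. -/
structure SURelations {B : Type*} [Ring B] [Algebra k B] (a b c d : B) : Prop where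
  ab : a * b = (q : k) • (b * a)
  ac : a * c = (q : k) • (c * a)
  ad : a * d = d * a + ((q : k) - (q : k)⁻¹) • (b * c)
  bc : b * c = c * b
  bd : b * d = (q : k) • (d * b)
  cd : c * d = (q : k) • (d * c)
  det : a * d - (q : k) • (b * c) = 1

theorem gen_relations : SURelations q (gen q .a) (gen q .b) (gen q .c) (gen q .d) where
  ab := by simpa [gen] using suMk_rel q (SURel.ab (q := q))
  ac := by simpa [gen] using suMk_rel q (SURel.ac (q := q))
  ad := by simpa [gen] using suMk_rel q (SURel.ad (q := q))
  bc := by simpa [gen] using suMk_rel q (SURel.bc (q := q))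
  bd := by simpa [gen] using suMk_rel q (SURel.bd (q := q))
  cd := by simpa [gen] using suMk_rel q (SURel.cd (q := q))
  det := by simpa [gen] using suMk_rel q (SURel.det (q := q))

/-- The images of the generators under a map out of `SU_q(2)`. -/
def genImage {B : Type*} (a b c d : B) : Gen → B
  | .a => a
  | .b => b
  | .c => c
  | .d => d

theorem suLift_aux {B : Type*} [Ring B] [Algebra k B] {a b c d : B}
    (h : SURelations q a b c d) ⦃x y : FreeAlgebra k Gen⦄ (hxy : SURel q x y) :
    FreeAlgebra.lift k (genImage a b c d) x = FreeAlgebra.lift k (genImage a b c d) y := by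
  induction hxy with
  | ab => simpa [genImage] using h.ab
  | ac => simpa [genImage] using h.ac
  | ad => simpa [genImage] using h.ad
  | bc => simpa [genImage] using h.bc
  | bd => simpa [genImage] using h.bd
  | cd => simpa [genImage] using h.cd
  | det => simpa [genImage] using h.det

/-- The universal property of `SU_q(2)`. -/
def suLift {B : Type*} [Ring B] [Algebra k B] {a b c d : B} (h : SURelations q a b c d) :
    SUq2 q →ₐ[k] B :=
  RingQuot.liftAlgHom k ⟨FreeAlgebra.lift k (genImage a b c d), suLift_aux q h⟩

@[simp]
theorem suLift_gen {B : Type*} [Ring B] [Algebra k B] {a b c d : B}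
    (h : SURelations q a b c d) (i : Gen) : suLift q h (gen q i) = genImage a b c d i := by
  have := RingQuot.liftAlgHom_mkAlgHom_apply (S := k) (FreeAlgebra.lift k (genImage a b c d))
    (suLift_aux q h) (FreeAlgebra.ι k i)
  refine Eq.trans this ?_
  simp

theorem su_hom_ext {B : Type*} [Ring B] [Algebra k B] {f g : SUq2 q →ₐ[k] B}
    (h : ∀ i, f (gen q i) = g (gen q i)) : f = g := by
  apply RingQuot.ringQuot_ext'
  apply FreeAlgebra.hom_ext
  funext i
  exact h i

theorem su_induction {C : SUq2 q → Prop} (hs : ∀ r : k, C (algebraMap k _ r))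
    (hg : ∀ i, C (gen q i)) (ha : ∀ x y, C x → C y → C (x + y))
    (hm : ∀ x y, C x → C y → C (x * y)) (x : SUq2 q) : C x := by
  obtain ⟨y, rfl⟩ : ∃ y, suMk q y = x := RingQuot.mkAlgHom_surjective k (SURel q) x
  induction y using FreeAlgebra.induction with
  | grade0 r => rw [AlgHom.commutes]; exact hs r
  | grade1 i => exact hg i
  | mul a b h1 h2 => rw [map_mul]; exact hm _ _ h1 h2
  | add a b h1 h2 => rw [map_add]; exact ha _ _ h1 h2

/-- `δα = 1 + q⁻¹βγ`. -/
theorem da_eq : gen q .d * gen q .a = 1 + (q : k)⁻¹ • (gen q .b * gen q .c) := by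
  have h1 := (gen_relations q).ad
  have h2 := (gen_relations q).det
  rw [h1, sub_smul] at h2
  rw [← h2]
  abel

theorem ad_eq : gen q .a * gen q .d = 1 + (q : k) • (gen q .b * gen q .c) := by
  rw [← (gen_relations q).det]
  abel

theorem comul_relations : SURelations q
    (gen q .a ⊗ₜ[k] gen q .a + gen q .b ⊗ₜ[k] gen q .c)
    (gen q .a ⊗ₜ[k] gen q .b + gen q .b ⊗ₜ[k] gen q .d)
    (gen q .c ⊗ₜ[k] gen q .a + gen q .d ⊗ₜ[k] gen q .c)
    (gen q .c ⊗ₜ[k] gen q .b + gen q .d ⊗ₜ[k] gen q .d) := by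
  have hq : (q : k) ≠ 0 := q.ne_zero
  obtain ⟨ab, ac, -, bc, bd, cd, -⟩ := gen_relations q
  have ad := ad_eq q
  have da := da_eq q
  generalize gen q .a = a at *
  generalize gen q .b = b at *
  generalize gen q .c = c at *
  generalize gen q .d = d at *
  constructor <;>
  simp only [add_mul, mul_add, Algebra.TensorProduct.tmul_mul_tmul, ab, ac, bd, cd, ad, da, ← bc,
    ← TensorProduct.smul_tmul', TensorProduct.tmul_smul, TensorProduct.add_tmul,
    TensorProduct.tmul_add, smul_add, sub_smul, smul_smul, one_smul,
    Algebra.TensorProduct.one_def, mul_inv_cancel₀ hq, inv_mul_cancel₀ hq, sub_mul] <;>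
  abel

/-- The comultiplication `Δ t_ij = Σ t_il ⊗ t_lj` of the matrix `((α, β), (γ, δ))`. -/
def suComul : SUq2 q →ₐ[k] SUq2 q ⊗[k] SUq2 q := suLift q (comul_relations q)

theorem counit_relations : SURelations q (1 : k) 0 0 1 := by
  constructor <;> simp

/-- The counit `ε t_ij = δ_ij`. -/
def suCounit : SUq2 q →ₐ[k] k := suLift q (counit_relations q)

theorem antipode_relations : SURelations q
    (MulOpposite.op (gen q .d)) (MulOpposite.op (-((q : k)⁻¹ • gen q .b)))
    (MulOpposite.op (-((q : k) • gen q .c))) (MulOpposite.op (gen q .a)) := by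
  have hq : (q : k) ≠ 0 := q.ne_zero
  obtain ⟨ab, ac, -, bc, bd, cd, -⟩ := gen_relations q
  have ad := ad_eq q
  have da := da_eq q
  generalize gen q .a = a at *
  generalize gen q .b = b at *
  generalize gen q .c = c at *
  generalize gen q .d = d at *
  constructor <;>
  simp only [← MulOpposite.op_mul, ← MulOpposite.op_smul, ← MulOpposite.op_add,
    ← MulOpposite.op_sub, ← MulOpposite.op_one, MulOpposite.op_inj,
    neg_mul, mul_neg, neg_neg, smul_mul_assoc, mul_smul_comm, ab, ac, bd, cd, ad, da, ← bc,
    smul_neg, sub_smul, smul_smul, one_smul,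
    mul_inv_cancel₀ hq, inv_mul_cancel₀ hq] <;>
  try abel

/-- The antipode, as an algebra map to the opposite algebra. -/
def suAntipodeHom : SUq2 q →ₐ[k] (SUq2 q)ᵐᵒᵖ := suLift q (antipode_relations q)

/-- The antipode `S(α) = δ`, `S(β) = -q⁻¹β`, `S(γ) = -qγ`, `S(δ) = α`. -/
def suAntipode : SUq2 q →ₗ[k] SUq2 q :=
  (MulOpposite.opLinearEquiv k).symm.toLinearMap ∘ₗ (suAntipodeHom q).toLinearMap

theorem suAntipode_gen (i : Gen) : suAntipode q (gen q i) =
    genImage (gen q .d) (-((q : k)⁻¹ • gen q .b)) (-((q : k) • gen q .c)) (gen q .a) i := by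
  cases i <;> simp [suAntipode, suAntipodeHom, genImage]

theorem suAntipode_mul (x y : SUq2 q) :
    suAntipode q (x * y) = suAntipode q y * suAntipode q x := by
  simp [suAntipode]

theorem suAntipode_algebraMap (r : k) :
    suAntipode q (algebraMap k _ r) = algebraMap k _ r := by
  simp [suAntipode]

theorem suAntipode_one : suAntipode q 1 = 1 := by
  simp [suAntipode]

instance : Bialgebra k (SUq2 q) := Bialgebra.ofAlgHom (suComul q) (suCounit q)
  (by
    apply su_hom_ext
    intro i
    cases i <;> simp [suComul, genImage, TensorProduct.add_tmul, TensorProduct.tmul_add] <;> abel)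
  (by
    apply su_hom_ext
    intro i
    cases i <;> simp [suComul, suCounit, genImage])
  (by
    apply su_hom_ext
    intro i
    cases i <;> simp [suComul, suCounit, genImage])

theorem su_comul_apply (x : SUq2 q) : Coalgebra.comul (R := k) x = suComul q x := rfl

theorem su_counit_apply (x : SUq2 q) : Coalgebra.counit (R := k) x = suCounit q x := rfl

instance : HopfAlgebra k (SUq2 q) where
  antipode := suAntipode q
  mul_antipode_rTensor_comul := by
    have hF : ∀ s t : SUq2 q ⊗[k] SUq2 q, ∀ r : k,
        LinearMap.mul' k (SUq2 q) ((suAntipode q).rTensor _ s) = algebraMap k _ r →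
        LinearMap.mul' k (SUq2 q) ((suAntipode q).rTensor _ (s * t)) =
          r • LinearMap.mul' k (SUq2 q) ((suAntipode q).rTensor _ t) := by
      intro s t r hs
      induction t with
      | zero => simp
      | add a b ha hb => simp only [mul_add, map_add, smul_add, ha, hb]
      | tmul a b =>
        have h2 : LinearMap.mul' k (SUq2 q) ((suAntipode q).rTensor _ (s * (a ⊗ₜ b))) =
            suAntipode q a * LinearMap.mul' k (SUq2 q) ((suAntipode q).rTensor _ s) * b := by
          clear hs
          induction s with
          | zero => simp
          | add x y hx hy => simp only [add_mul, mul_add, map_add, hx, hy]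
          | tmul x y => simp [suAntipode_mul, mul_assoc]
        rw [h2, hs, ← Algebra.commutes, mul_assoc, ← Algebra.smul_def]
        simp
    ext x
    simp only [LinearMap.comp_apply, su_comul_apply, su_counit_apply, Algebra.linearMap_apply]
    induction x using su_induction with
    | hs r =>
      simp [Algebra.TensorProduct.algebraMap_apply, suAntipode_algebraMap]
    | hg i =>
      have hq : (q : k) ≠ 0 := q.ne_zero
      obtain ⟨ab, ac, -, bc, bd, cd, -⟩ := gen_relations q
      cases i <;> simp [suComul, suCounit, genImage, suAntipode_gen, ad_eq, da_eq, ac, bd, ← bc]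
    | ha x y hx hy => simp only [map_add, hx, hy]
    | hm x y hx hy =>
      rw [map_mul, hF _ _ _ hx, hy, map_mul, map_mul, Algebra.smul_def]
  mul_antipode_lTensor_comul := by
    have hF : ∀ s t : SUq2 q ⊗[k] SUq2 q, ∀ r : k,
        LinearMap.mul' k (SUq2 q) ((suAntipode q).lTensor _ t) = algebraMap k _ r →
        LinearMap.mul' k (SUq2 q) ((suAntipode q).lTensor _ (s * t)) =
          r • LinearMap.mul' k (SUq2 q) ((suAntipode q).lTensor _ s) := by
      intro s t r hs
      induction s with
      | zero => simp
      | add a b ha hb => simp only [add_mul, map_add, smul_add, ha, hb]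
      | tmul a b =>
        have h2 : LinearMap.mul' k (SUq2 q) ((suAntipode q).lTensor _ ((a ⊗ₜ b) * t)) =
            a * LinearMap.mul' k (SUq2 q) ((suAntipode q).lTensor _ t) * suAntipode q b := by
          clear hs
          induction t with
          | zero => simp
          | add x y hx hy => simp only [add_mul, mul_add, map_add, hx, hy]
          | tmul x y => simp [suAntipode_mul, mul_assoc]
        rw [h2, hs, ← Algebra.commutes, mul_assoc, ← Algebra.smul_def]
        simp
    ext x
    simp only [LinearMap.comp_apply, su_comul_apply, su_counit_apply, Algebra.linearMap_apply]
    induction x using su_induction with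
    | hs r =>
      simp [Algebra.TensorProduct.algebraMap_apply, suAntipode_one]
    | hg i =>
      have hq : (q : k) ≠ 0 := q.ne_zero
      obtain ⟨ab, ac, -, bc, bd, cd, -⟩ := gen_relations q
      cases i <;> simp [suComul, suCounit, genImage, suAntipode_gen, ad_eq, da_eq, ab, cd,
        smul_smul, ← bc]
    | ha x y hx hy => simp only [map_add, hx, hy]
    | hm x y hx hy =>
      rw [map_mul, hF _ _ _ hy, hx, map_mul, map_mul, Algebra.smul_def, Algebra.commutes]

end SUq2
section Monopole

open LaurentPolynomial

variable {k : Type*} [Field k] (q : kˣ)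

/-- `SO_q(3)`, the subalgebra of even elements of `SU_q(2)`, generated by the products of two
generators. -/
def SOq3 : Subalgebra k (SUq2 q) :=
  Algebra.adjoin k {x | ∃ i j, x = gen q i * gen q j}

theorem isHopfSubalgebra_SOq3 : IsHopfSubalgebra (SOq3 q) where
  comul_mem := by
    have hg : ∀ i j i' j' : Gen, (gen q i * gen q j) ⊗ₜ[k] (gen q i' * gen q j') ∈
        (Algebra.TensorProduct.map (SOq3 q).val (SOq3 q).val).range := fun i j i' j' =>
      ⟨(⟨_, Algebra.subset_adjoin ⟨i, j, rfl⟩⟩ : SOq3 q) ⊗ₜ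
        (⟨_, Algebra.subset_adjoin ⟨i', j', rfl⟩⟩ : SOq3 q), by simp⟩
    have hle : SOq3 q ≤ (Algebra.TensorProduct.map (SOq3 q).val (SOq3 q).val).range.comap
        (suComul q) := by
      refine Algebra.adjoin_le ?_
      rintro _ ⟨i, j, rfl⟩
      rw [SetLike.mem_coe, Subalgebra.mem_comap, map_mul]
      cases i <;> cases j <;>
        simp only [suComul, suLift_gen, genImage, add_mul, mul_add,
          Algebra.TensorProduct.tmul_mul_tmul] <;>
        exact add_mem (add_mem (hg _ _ _ _) (hg _ _ _ _)) (add_mem (hg _ _ _ _) (hg _ _ _ _))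
    exact fun x hx => hle hx
  antipode_mem := by
    intro x hx
    change suAntipode q x ∈ _
    induction hx using Algebra.adjoin_induction with
    | mem x hx =>
      obtain ⟨i, j, rfl⟩ := hx
      have hg : ∀ i j : Gen, gen q i * gen q j ∈ SOq3 q := fun i j =>
        Algebra.subset_adjoin ⟨i, j, rfl⟩
      rw [suAntipode_mul, suAntipode_gen, suAntipode_gen]
      cases i <;> cases j <;>
        simp only [genImage, neg_mul, mul_neg, neg_neg, smul_mul_assoc, mul_smul_comm,
          smul_neg] <;>
        first
        | exact hg _ _
        | exact neg_mem (Subalgebra.smul_mem _ (hg _ _) _)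
        | exact Subalgebra.smul_mem _ (Subalgebra.smul_mem _ (hg _ _) _) _
    | algebraMap r =>
      rw [suAntipode_algebraMap]
      exact Subalgebra.algebraMap_mem _ r
    | add x y _ _ hx hy => rw [map_add]; exact add_mem hx hy
    | mul x y _ _ hx hy => rw [suAntipode_mul]; exact mul_mem hy hx

instance : HopfAlgebra k (SOq3 q) := subHopfAlgebra (SOq3 q) (isHopfSubalgebra_SOq3 q)

theorem piSU_relations : SURelations q (T 1 : k[T;T⁻¹]) 0 0 (T (-1)) := by
  have h1 : (T 1 * T (-1) : k[T;T⁻¹]) = 1 := by rw [← T_add]; exact T_zero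
  have h2 : (T (-1) * T 1 : k[T;T⁻¹]) = 1 := by rw [← T_add]; exact T_zero
  constructor <;>
    simp only [mul_zero, zero_mul, smul_zero, add_zero, sub_zero, h1, h2]

/-- The Hopf algebra map `SU_q(2) → k[Z^{1/2}, Z^{-1/2}]`, `α ↦ Z^{1/2}`, `β, γ ↦ 0`,
`δ ↦ Z^{-1/2}`, the Laurent variable being `Z^{1/2}`. -/
def piSU : SUq2 q →ₐ[k] k[T;T⁻¹] := suLift q (piSU_relations q)

/-- The inclusion `k[Z, Z⁻¹] → k[Z^{1/2}, Z^{-1/2}]`. -/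
def sqIncl : k[T;T⁻¹] →ₐ[k] k[T;T⁻¹] :=
  AddMonoidAlgebra.mapDomainAlgHom k k (zmultiplesHom ℤ (2 : ℤ))

theorem sqIncl_T (n : ℤ) : sqIncl (T n : k[T;T⁻¹]) = T (2 * n) := by
  simp [sqIncl, T, mul_comm, -single_eq_C_mul_T]

theorem sqIncl_injective : Function.Injective (sqIncl (k := k)) :=
  AddMonoidAlgebra.mapDomain_injective (by
    intro m n h
    simpa using h)

theorem piSU_mem (x : SOq3 q) : piSU q x ∈ (sqIncl (k := k)).range := by
  have hle : SOq3 q ≤ (sqIncl (k := k)).range.comap (piSU q) := by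
    refine Algebra.adjoin_le ?_
    rintro _ ⟨i, j, rfl⟩
    rw [SetLike.mem_coe, Subalgebra.mem_comap, map_mul]
    have h1 : ∀ n : ℤ, (T (2 * n) : k[T;T⁻¹]) ∈ (sqIncl (k := k)).range :=
      fun n => ⟨T n, sqIncl_T n⟩
    have h2 := h1 1
    have h0 := h1 0
    have h3 := h1 (-1)
    cases i <;> cases j <;>
      simp only [piSU, suLift_gen, genImage, mul_zero, zero_mul, zero_mem, ← T_add] <;>
      assumption
  exact hle x.2

/-- The projection `π : SO_q(3) → A = k[Z, Z⁻¹]`, the restriction of `piSU`. -/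
def piSO : SOq3 q →ₐ[k] k[T;T⁻¹] :=
  (AlgEquiv.ofInjective _ sqIncl_injective).symm.toAlgHom.comp
    (((piSU q).comp (SOq3 q).val).codRestrict _ (piSU_mem q))

theorem sqIncl_piSO (x : SOq3 q) : sqIncl (piSO q x) = piSU q x :=
  congrArg Subtype.val (AlgEquiv.apply_symm_apply (AlgEquiv.ofInjective _ sqIncl_injective)
    (((piSU q).comp (SOq3 q).val).codRestrict _ (piSU_mem q) x))

/-- The coaction `Δ_R = (id ⊗ π) Δ` of `k[Z, Z⁻¹]` on `SO_q(3)`. -/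
def monopoleCoaction : SOq3 q →ₐ[k] SOq3 q ⊗[k] k[T;T⁻¹] :=
  (Algebra.TensorProduct.map (.id k _) (piSO q)).comp (Bialgebra.comulAlgHom k (SOq3 q))

/-- The right ideal of `SU_q(2)` defining the 3D calculus. -/
def ideal3D : Submodule k (SUq2 q) :=
  (Submodule.span (SUq2 q)ᵐᵒᵖ
    {gen q .d + (q : k) ^ 2 • gen q .a - (1 + (q : k) ^ 2) • 1,
      gen q .c ^ 2, gen q .b * gen q .c, gen q .b ^ 2,
      (gen q .a - 1) * gen q .c, (gen q .a - 1) * gen q .b}).restrictScalars k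

/-- The sub-bimodule of `SU_q(2)²` defining the 3D calculus on `SU_q(2)`. -/
def calculusSU : Submodule (SUq2 q) (universalForms k (SUq2 q)) := leftCovariant (ideal3D q)

/-- The 3D calculus on `SO_q(3)`, inherited from that on `SU_q(2)`. -/
def calculusSO : Submodule (SOq3 q) (universalForms k (SOq3 q)) :=
  inherited (SOq3 q).val (calculusSU q)

/-- The right ideal `M_P` of `SO_q(3)`, the restriction of the ideal of `SU_q(2)`. -/
def idealSO : Submodule k (SOq3 q) := (ideal3D q).comap (SOq3 q).val.toLinearMap

/-- The ideal `M_A = π(M_P)` of `k[Z, Z⁻¹]`. -/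
def idealA : Submodule k k[T;T⁻¹] := (idealSO q).map (piSO q).toLinearMap

/-- The left-invariant form `ω¹ = δ dα - q⁻¹ β dγ` of the 3D calculus. -/
def omega1 : Forms (calculusSU q) :=
  gen q .d • diff (calculusSU q) (gen q .a) -
    (q : k)⁻¹ • gen q .b • diff (calculusSU q) (gen q .c)

/-- The two-sided ideal `J = ker (SU_q(2) → k[Z^{1/2}, Z^{-1/2}])`, generated by `β, γ`. -/
def kerPi : Ideal (SUq2 q) := RingHom.ker (piSU q)

instance : (kerPi q).IsTwoSided := inferInstanceAs (RingHom.ker (piSU q)).IsTwoSided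

/-- The truncation `SU_q(2) / J ^ n`. -/
abbrev Trunc (n : ℕ) : Type _ := SUq2 q ⧸ (kerPi q) ^ n

/-- The quotient map `SU_q(2) / J ^ n → SU_q(2) / J ^ m` for `m ≤ n`. -/
def truncMap {m n : ℕ} (h : m ≤ n) : Trunc q n →+* Trunc q m :=
  Ideal.Quotient.factor (Ideal.pow_le_pow_right h)

/-- The completion `lim SU_q(2) / J ^ n`: formal power series in `β, γ`. -/
def Completion : Subalgebra k (∀ n : ℕ, Trunc q n) where
  carrier := {x | ∀ (m n : ℕ) (h : m ≤ n), truncMap q h (x n) = x m}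
  mul_mem' := by
    intro x y hx hy m n h
    simp only [Pi.mul_apply, map_mul, hx m n h, hy m n h]
  add_mem' := by
    intro x y hx hy m n h
    simp only [Pi.add_apply, map_add, hx m n h, hy m n h]
  algebraMap_mem' := fun r m n h => rfl

/-- The canonical map of `SU_q(2)` to its completion. -/
def toCompletion : SUq2 q →ₐ[k] Completion q :=
  (AlgHom.pi (R := k) (fun n => Ideal.Quotient.mkₐ k (kerPi q ^ n))).codRestrict _
    (fun _ _ _ _ => rfl)

theorem isUnit_completion (x : Completion q) (hx : ∀ n, IsUnit (x.1 n)) : IsUnit x := by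
  choose u hu using hx
  have hc : (fun n => (↑(u n)⁻¹ : Trunc q n)) ∈ Completion q := by
    intro m n h
    have h1 : Units.map (truncMap q h : Trunc q n →* Trunc q m) (u n) = u m := by
      ext
      simp only [Units.coe_map, MonoidHom.coe_coe, hu]
      exact x.2 m n h
    change truncMap q h ↑(u n)⁻¹ = ↑(u m)⁻¹
    rw [← h1]
    rfl
  refine ⟨⟨x, ⟨_, hc⟩, ?_, ?_⟩, rfl⟩
  · ext n
    simp [← hu]
  · ext n
    simp [← hu]

theorem isUnit_one_add_trunc (n : ℕ) (x : SUq2 q) (hx : x ∈ kerPi q) :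
    IsUnit (Ideal.Quotient.mk (kerPi q ^ n) (1 + x)) := by
  have : IsNilpotent (Ideal.Quotient.mk (kerPi q ^ n) x) := by
    refine ⟨n, ?_⟩
    rw [← map_pow]
    exact Ideal.Quotient.eq_zero_iff_mem.2 (Ideal.pow_mem_pow hx n)
  rw [map_add, map_one]
  exact this.isUnit_one_add

theorem bc_mem_kerPi (r : k) : r • (gen q .b * gen q .c) ∈ kerPi q := by
  rw [kerPi, RingHom.mem_ker]
  simp [piSU, genImage]

theorem isUnit_trunc (n : ℕ) : IsUnit (Ideal.Quotient.mk (kerPi q ^ n) (gen q .a)) ∧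
    IsUnit (Ideal.Quotient.mk (kerPi q ^ n) (gen q .d)) := by
  have h1 := isUnit_one_add_trunc q n _ (bc_mem_kerPi q (q : k))
  have h2 := isUnit_one_add_trunc q n _ (bc_mem_kerPi q (q : k)⁻¹)
  rw [← ad_eq, map_mul] at h1
  rw [← da_eq, map_mul] at h2
  obtain ⟨x, hx⟩ := h1.exists_right_inv
  obtain ⟨x', hx'⟩ := h1.exists_left_inv
  obtain ⟨y, hy⟩ := h2.exists_right_inv
  obtain ⟨y', hy'⟩ := h2.exists_left_inv
  rw [mul_assoc] at hx hy
  rw [← mul_assoc] at hx' hy'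
  exact ⟨isUnit_iff_exists_and_exists.2 ⟨⟨_, hx⟩, ⟨_, hy'⟩⟩,
    isUnit_iff_exists_and_exists.2 ⟨⟨_, hy⟩, ⟨_, hx'⟩⟩⟩

/-- `α` as a unit of the completion. -/
def alphaUnit : (Completion q)ˣ :=
  (isUnit_completion q (toCompletion q (gen q .a)) (fun n => (isUnit_trunc q n).1)).unit

/-- `δ` as a unit of the completion. -/
def deltaUnit : (Completion q)ˣ :=
  (isUnit_completion q (toCompletion q (gen q .d)) (fun n => (isUnit_trunc q n).2)).unit

/-- The localization `P₀ = SO_q(3)[δ⁻¹α, α⁻¹δ]`, inside the completion. -/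
def Loc : Subalgebra k (Completion q) :=
  Algebra.adjoin k (Set.range (fun u : SOq3 q => toCompletion q u) ∪
    {(↑((deltaUnit q)⁻¹ * alphaUnit q) : Completion q),
      (↑((alphaUnit q)⁻¹ * deltaUnit q) : Completion q)})

/-- The unit `δ⁻¹α` of `P₀`, with inverse `α⁻¹δ`. -/
def fibreUnit : (Loc q)ˣ where
  val := ⟨↑((deltaUnit q)⁻¹ * alphaUnit q), Algebra.subset_adjoin (by simp)⟩
  inv := ⟨↑((alphaUnit q)⁻¹ * deltaUnit q), Algebra.subset_adjoin (by simp)⟩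
  val_inv := Subtype.ext (by
    rw [Subalgebra.coe_mul, ← Units.val_mul]
    simp [mul_assoc])
  inv_val := Subtype.ext (by
    rw [Subalgebra.coe_mul, ← Units.val_mul]
    simp [mul_assoc])

/-- The algebra map `k[Z, Z⁻¹] → B`, `Z ↦ u`, for an invertible element `u` of `B`. -/
def laurentLift {B : Type*} [Semiring B] [Algebra k B] (u : Bˣ) : k[T;T⁻¹] →ₐ[k] B :=
  AddMonoidAlgebra.lift k B ℤ ((Units.coeHom B).comp (zpowersHom Bˣ u))

theorem laurentLift_T {B : Type*} [Semiring B] [Algebra k B] (u : Bˣ) (n : ℤ) :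
    laurentLift u (T n : k[T;T⁻¹]) = ↑(u ^ n) := by
  simp [laurentLift, T, -single_eq_C_mul_T]

/-- The algebra map `i : k[Z, Z⁻¹] → P₀`, `i(Z) = δ⁻¹α`. -/
def iMap : k[T;T⁻¹] →ₐ[k] Loc q := laurentLift (fibreUnit q)

/-- `ω(a) = Σ S(i(a)₍₁₎) d i(a)₍₂₎`. The element `i(a)` of `P₀` is a formal power series and so is
its coproduct; the formula is the value at `i(a)` of the extension by `J`-adic continuity of
`u ↦ Σ S(u₍₁₎) d u₍₂₎`, that is, the common value of `Σ S(u₍₁₎) d u₍₂₎` on all `u` in `SO_q(3)`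
that agree with `i(a)` to sufficiently high order. -/
def IsCanonicalMap (ω : k[T;T⁻¹] →ₗ[k] Forms (calculusSO q)) : Prop :=
  ∀ a : k[T;T⁻¹], ∃ n : ℕ, ∀ u : SOq3 q,
    Ideal.Quotient.mk (kerPi q ^ n) (u : SUq2 q) = (iMap q a : Completion q).1 n →
      maurerCartan (calculusSO q) u = ω a

/-- `[n]_x = (x ^ n - 1) / (x - 1)`, with the limiting value `n` at `x = 1`. -/
def qNumber (x : k) (n : ℕ) : k :=
  open Classical in if x = 1 then (n : k) else (x ^ n - 1) / (x - 1)

/-- `f(xZ)`. -/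
def rescale (x : k) (f : k[T;T⁻¹]) : k[T;T⁻¹] :=
  f.coeff.sum fun n r => C (r * x ^ n) * T n

/-- Jackson's derivative `D_x f(Z) = (f(xZ) - f(Z)) / ((x - 1) Z)` of a Laurent polynomial, with
the limiting value, the ordinary derivative, at `x = 1`. -/
def jackson (x : k) (f : k[T;T⁻¹]) : k[T;T⁻¹] :=
  open Classical in
  if x = 1 then f.coeff.sum fun n r => C (r * (n : k)) * T (n - 1)
  else C (x - 1)⁻¹ * T (-1) * (rescale x f - f)

/-- `f(Z)|_{Z = 1}`. -/
def evalOne (f : k[T;T⁻¹]) : k := eval₂ (RingHom.id k) 1 f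

end Monopole
end QuantumBundle

end

/-!
The 3D calculus is controlled by three functionals `f₀, f₁, f₂` on `SU_q(2)` (`tangent`), the
off-diagonal entries of two-dimensional triangular representations (`tangentRep`): modulo the
ideal `M` every `x` is `ε(x) + f₀(x) (α - 1) + f₁(x) β + f₂(x) γ`, so that `M` is the common
kernel of `ε` and the `f_i` (`mem_ideal3D_iff`). As `κ` is bijective with inverse `u ⊗ v ↦ Σ u
v₍₁₎ ⊗ v₍₂₎`, the relations of the calculus are the forms on which the three left-linear
coordinates `F_i(u dv) = Σ u v₍₁₎ f_i(v₍₂₎)` vanish (`mem_leftCovariant_iff`,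
`mem_calculusSO_iff`), and the Maurer–Cartan form `Σ S(u₍₁₎) du₍₂₎` has the constant coordinates
`f_i(u)`. All questions about 1-forms become questions about these coordinates.

The functional `f₀` factors through `π` as `f₀ = X ∘ π`, where `X(Zⁿ) = [2]_{q⁻²} [n]_{q⁻⁴}`, that
is `X(f) = [2]_{q⁻²} D_{q⁻⁴} f (1)` (`fibreTangent_eq_jackson`), and `M_A = ker ε ∩ ker X`
(`mem_idealA_iff`). Hence `ker ε / M_A` embeds into `k` by `X`, and the map `Γ_P → P ⊗ ker ε /
M_A` becomes the coordinate `F₀`. Its kernel is the left `P`-span of the Maurer–Cartan forms of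
the coinvariants `αβ` and `γδ`, which are horizontal because `Δ B ⊆ P ⊗ B` (`mem_horizontal_iff`);
each `f_i` is homogeneous for the grading by `A`, which gives the covariance of the calculus
(`coactUniv_mem`) and of the projection `ρ ↦ F₀(ρ) ω¹` (`isConnection_of_coord`). The form `ω¹`,
with coordinates `(1, 0, 0)`, lies in `Γ_P` as a multiple of the Maurer–Cartan form of `α²`; this
is where `q² ≠ -1` is needed.

The connection form is then `ω(f) = X(f) ω¹`. It is the canonical map because the representations
defining the `f_i` kill `J²`, so that `f_i(u)` for `u ≡ i(f)` modulo `J²` is computed by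
substituting for `Z` the matrix of `δ⁻¹α` (`tangent_eq_of_approx`). It is the only one because
`SO_q(3)` is `J`-adically dense in `P₀`: the inverses of `α` and `δ` are geometric series in `βγ`
(`exists_approx`).
-/

open scoped TensorProduct

noncomputable section

namespace QuantumBundle

/-! ### Tensor products and common kernels of linear functionals -/

section CommonKernel

variable {k : Type*} [Field k] {V W E : Type*} [AddCommGroup V] [Module k V]
  [AddCommGroup W] [Module k W] [AddCommGroup E] [Module k E] {ι : Type*} [Fintype ι]

theorem rTensor_pi_eq_zero (f : ι → V →ₗ[k] W) {x : V ⊗[k] E}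
    (hx : ∀ i, (f i).rTensor E x = 0) : (LinearMap.pi f).rTensor E x = 0 := by
  classical
  have h : LinearMap.pi f = ∑ i, LinearMap.single k (fun _ : ι => W) i ∘ₗ f i := by
    ext v j
    simp [Pi.single_apply]
  have h' : (LinearMap.pi f).rTensor E =
      ∑ i, (LinearMap.single k (fun _ : ι => W) i).rTensor E ∘ₗ (f i).rTensor E := by
    change LinearMap.rTensorHom E (LinearMap.pi f) = _
    rw [h, map_sum]
    simp [LinearMap.rTensorHom, LinearMap.rTensor_comp]
  rw [h', LinearMap.sum_apply]
  simp [hx]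

/-- Flatness of `E`: a tensor in `V ⊗ E` killed by the maps `f i ⊗ id` lies in `N ⊗ E`, where
`N` is the common kernel of the `f i`. -/
theorem mem_range_rTensor (N : Submodule k V) (f : ι → V →ₗ[k] W)
    (hN : ∀ v, v ∈ N ↔ ∀ i, f i v = 0) {x : V ⊗[k] E} (hx : ∀ i, (f i).rTensor E x = 0) :
    x ∈ LinearMap.range (N.subtype.rTensor E) := by
  have hex : Function.Exact N.subtype (LinearMap.pi f) := by
    intro v
    rw [Submodule.coe_subtype, Subtype.range_coe, SetLike.mem_coe, hN, funext_iff]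
    rfl
  exact (Module.Flat.rTensor_exact E hex x).1 (rTensor_pi_eq_zero f hx)

theorem mem_range_lTensor (N : Submodule k V) (f : ι → V →ₗ[k] W)
    (hN : ∀ v, v ∈ N ↔ ∀ i, f i v = 0) {x : E ⊗[k] V} (hx : ∀ i, (f i).lTensor E x = 0) :
    x ∈ LinearMap.range (N.subtype.lTensor E) := by
  have h := mem_range_rTensor (E := E) N f hN (x := TensorProduct.comm k E V x) (by
    intro i
    rw [← LinearMap.comm_comp_lTensor_comp_comm_eq, LinearMap.comp_apply, LinearMap.comp_apply,
      LinearEquiv.coe_coe, LinearEquiv.coe_coe,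
      show TensorProduct.comm k V E (TensorProduct.comm k E V x) = x from
        (TensorProduct.comm k E V).symm_apply_apply x, hx, map_zero])
  obtain ⟨y, hy⟩ := h
  refine ⟨TensorProduct.comm k N E y, ?_⟩
  rw [← (TensorProduct.comm k E V).injective.eq_iff, ← hy]
  clear hy
  induction y with
  | zero => simp
  | add a b ha hb => simp only [map_add, ha, hb]
  | tmul a b => simp

end CommonKernel

/-! ### Frames of left-covariant calculi -/

section Frames

variable {k : Type*} [Field k] {P : Type*} [Ring P] [HopfAlgebra k P]

/-- The left-invariant operator `v ↦ Σ v₍₁₎ f(v₍₂₎)` on a Hopf algebra given by a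
functional `f`. -/
def invOp (f : P →ₗ[k] k) : P →ₗ[k] P :=
  (TensorProduct.rid k P).toLinearMap ∘ₗ f.lTensor P ∘ₗ Coalgebra.comul

/-- The coordinate `P ⊗ P → P`, `u ⊗ v ↦ Σ u v₍₁₎ f(v₍₂₎)`, given by a functional `f`. On a
calculus of which `f` is a tangent functional it is the left `P`-linear extension of
`Σ S(v₍₁₎) d v₍₂₎ ↦ f(v)`. -/
def coord (f : P →ₗ[k] k) : P ⊗[k] P →ₗ[P] P :=
  TensorProduct.AlgebraTensorModule.lift
    (LinearMap.toSpanSingleton P (P →ₗ[k] P) (invOp f))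

@[simp]
theorem coord_tmul (f : P →ₗ[k] k) (u v : P) : coord f (u ⊗ₜ v) = u * invOp f v := by
  simp [coord]

theorem canonicalMap_kappa (t : P ⊗[k] P) :
    canonicalMap (Bialgebra.comulAlgHom k P) (kappa k P t) = t := by
  induction t with
  | zero => simp
  | add a b ha hb => simp only [map_add, ha, hb]
  | tmul a b =>
    rw [kappa_tmul, map_smul]
    have key : ∀ s : P ⊗[k] P,
        canonicalMap (Bialgebra.comulAlgHom k P)
          ((HopfAlgebra.antipode k (A := P)).rTensor P s) =
        (LinearMap.mul' k P ∘ₗ (HopfAlgebra.antipode k (A := P)).rTensor P).rTensor P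
          ((TensorProduct.assoc k P P P).symm
            ((Coalgebra.comul (R := k) (A := P)).lTensor P s)) := by
      intro s
      induction s with
      | zero => simp
      | add a b ha hb => simp only [map_add, ha, hb]
      | tmul x y =>
        simp only [LinearMap.rTensor_tmul, canonicalMap_tmul, LinearMap.lTensor_tmul,
          Bialgebra.comulAlgHom_apply]
        generalize Coalgebra.comul (R := k) y = z
        induction z with
        | zero => simp
        | add a b ha hb => simp only [map_add, smul_add, TensorProduct.tmul_add, ha, hb]
        | tmul y z => simp [TensorProduct.smul_tmul']
    rw [key, ← Coalgebra.coassoc_apply, LinearEquiv.symm_apply_apply, ← LinearMap.comp_apply,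
      ← LinearMap.rTensor_comp]
    have h : (LinearMap.mul' k P ∘ₗ (HopfAlgebra.antipode k (A := P)).rTensor P) ∘ₗ
        Coalgebra.comul = Algebra.linearMap k P ∘ₗ Coalgebra.counit :=
      HopfAlgebra.mul_antipode_rTensor_comul
    rw [h, LinearMap.rTensor_comp, LinearMap.comp_apply, Coalgebra.rTensor_counit_comul]
    simp [TensorProduct.smul_tmul']

theorem kappa_canonicalMap (t : P ⊗[k] P) :
    kappa k P (canonicalMap (Bialgebra.comulAlgHom k P) t) = t := by
  induction t with
  | zero => simp
  | add a b ha hb => simp only [map_add, ha, hb]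
  | tmul a b =>
    rw [canonicalMap_tmul, map_smul, Bialgebra.comulAlgHom_apply]
    have key : ∀ s : P ⊗[k] P, kappa k P s =
        (LinearMap.mul' k P ∘ₗ (HopfAlgebra.antipode k (A := P)).lTensor P).rTensor P
          ((TensorProduct.assoc k P P P).symm
            ((Coalgebra.comul (R := k) (A := P)).lTensor P s)) := by
      intro s
      induction s with
      | zero => simp
      | add a b ha hb => simp only [map_add, ha, hb]
      | tmul x y =>
        simp only [kappa_tmul, LinearMap.lTensor_tmul]
        generalize Coalgebra.comul (R := k) y = z
        induction z with
        | zero => simp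
        | add a b ha hb => simp only [map_add, smul_add, TensorProduct.tmul_add, ha, hb]
        | tmul y z => simp [TensorProduct.smul_tmul']
    rw [key, ← Coalgebra.coassoc_apply, LinearEquiv.symm_apply_apply, ← LinearMap.comp_apply,
      ← LinearMap.rTensor_comp]
    have h : (LinearMap.mul' k P ∘ₗ (HopfAlgebra.antipode k (A := P)).lTensor P) ∘ₗ
        Coalgebra.comul = Algebra.linearMap k P ∘ₗ Coalgebra.counit :=
      HopfAlgebra.mul_antipode_lTensor_comul
    rw [h, LinearMap.rTensor_comp, LinearMap.comp_apply, Coalgebra.rTensor_counit_comul]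
    simp [TensorProduct.smul_tmul']

theorem coord_eq (f : P →ₗ[k] k) (t : P ⊗[k] P) : coord f t =
    TensorProduct.rid k P (f.lTensor P (canonicalMap (Bialgebra.comulAlgHom k P) t)) := by
  induction t with
  | zero => simp
  | add a b ha hb => simp only [map_add, ha, hb]
  | tmul u v =>
    simp only [coord_tmul, canonicalMap_tmul, Bialgebra.comulAlgHom_apply, invOp,
      LinearMap.comp_apply, LinearEquiv.coe_coe]
    generalize Coalgebra.comul (R := k) v = z
    induction z with
    | zero => simp
    | add a b ha hb => simp only [map_add, smul_add, mul_add, ha, hb]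
    | tmul y z => simp [TensorProduct.smul_tmul']

theorem coord_kappa (f : P →ₗ[k] k) (a b : P) : coord f (kappa k P (a ⊗ₜ b)) = f b • a := by
  rw [coord_eq, canonicalMap_kappa]
  simp

theorem invOp_counit (v : P) : invOp (Coalgebra.counit (R := k) (A := P)) v = v := by
  simp [invOp]

theorem coord_counit (t : P ⊗[k] P) :
    coord (Coalgebra.counit (R := k) (A := P)) t = LinearMap.mul' k P t := by
  induction t with
  | zero => simp
  | add a b ha hb => simp only [map_add, ha, hb]
  | tmul u v => simp [invOp_counit]

theorem invOp_one {f : P →ₗ[k] k} (hf : f 1 = 0) : invOp f 1 = 0 := by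
  simp [invOp, Algebra.TensorProduct.one_def, hf]

theorem coord_formOf {f : P →ₗ[k] k} (hf : f 1 = 0) (t : P ⊗[k] P) :
    coord f (formOf k P t : P ⊗[k] P) = coord f t := by
  change coord f (t - LinearMap.mul' k P t ⊗ₜ[k] (1 : P)) = _
  simp [invOp_one hf]

/-- A left-covariant calculus given by the common kernel `M` of the counit and of functionals
`f i` consists of the forms with vanishing coordinates. -/
theorem mem_leftCovariant_iff {ι : Type*} [Fintype ι] {M : Submodule k P} (f : ι → P →ₗ[k] k)
    (hM : ∀ x, x ∈ M ↔ Coalgebra.counit (R := k) x = 0 ∧ ∀ i, f i x = 0)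
    (ρ : universalForms k P) :
    ρ ∈ leftCovariant M ↔ ∀ i, coord (f i) (ρ : P ⊗[k] P) = 0 := by
  constructor
  · rintro ⟨x, hx, hρ⟩ i
    rw [← Submodule.subtype_apply, ← hρ]
    rw [SetLike.mem_coe, Submodule.baseChange_eq_span] at hx
    clear hρ
    induction hx using Submodule.span_induction with
    | mem x h =>
      obtain ⟨m, hm, rfl⟩ := h
      rw [TensorProduct.mk_apply, coord_kappa, ((hM m).1 hm).2 i, zero_smul]
    | zero => simp
    | add x y _ _ hx hy => rw [map_add, map_add, hx, hy, add_zero]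
    | smul c x _ hx => rw [map_smul, map_smul, hx, smul_zero]
  · intro h
    refine ⟨canonicalMap (Bialgebra.comulAlgHom k P) (ρ : P ⊗[k] P), ?_, kappa_canonicalMap _⟩
    have h1 : canonicalMap (Bialgebra.comulAlgHom k P) (ρ : P ⊗[k] P) ∈
        LinearMap.range (M.subtype.lTensor P) := by
      -- The counit, whose coordinate is the multiplication, accounts for `ρ` being in `P²`.
      refine mem_range_lTensor (ι := Option ι) M
        (fun i => i.elim (Coalgebra.counit (R := k) (A := P)) f) ?_ ?_
      · intro v
        rw [hM, Option.forall]
        rfl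
      · intro i
        apply (TensorProduct.rid k P).injective
        rw [← coord_eq, map_zero]
        cases i with
        | none => exact (coord_counit _).trans ρ.2
        | some i => exact h i
    obtain ⟨y, hy⟩ := h1
    rw [← hy]
    clear hy
    induction y with
    | zero => simp
    | add a b ha hb => rw [map_add]; exact add_mem ha hb
    | tmul a b => exact Submodule.tmul_mem_baseChange_of_mem _ b.2

/-- `f` is an `(ε, χ)`-derivation, `f(xy) = ε(x) f(y) + f(x) χ(y)`, that is, a skew-primitive
element of the dual. The operator `invOp f` is then a derivation twisted by `invOp χ`. -/
def IsSkew (f : P →ₗ[k] k) (χ : P →ₐ[k] k) : Prop :=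
  ∀ x y, f (x * y) = Coalgebra.counit (R := k) x * f y + f x * χ y

theorem IsSkew.one {f : P →ₗ[k] k} {χ : P →ₐ[k] k} (h : IsSkew f χ) : f 1 = 0 := by
  simpa using h 1 1

theorem IsSkew.invOp_mul {f : P →ₗ[k] k} {χ : P →ₐ[k] k} (h : IsSkew f χ) (u v : P) :
    invOp f (u * v) = u * invOp f v + invOp f u * invOp χ.toLinearMap v := by
  have key : ∀ s t : P ⊗[k] P, TensorProduct.rid k P (f.lTensor P (s * t)) =
      TensorProduct.rid k P ((Coalgebra.counit (R := k) (A := P)).lTensor P s) *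
        TensorProduct.rid k P (f.lTensor P t) +
      TensorProduct.rid k P (f.lTensor P s) *
        TensorProduct.rid k P (χ.toLinearMap.lTensor P t) := by
    intro s t
    induction s with
    | zero => simp
    | add a b ha hb => simp only [add_mul, map_add, ha, hb]; abel
    | tmul a b =>
      induction t with
      | zero => simp
      | add x y hx hy => simp only [mul_add, map_add, hx, hy]; abel
      | tmul x y =>
        simp [h b y, add_smul, smul_smul, mul_comm]
  have := key (Coalgebra.comul (R := k) u) (Coalgebra.comul (R := k) v)
  simpa [invOp] using this

theorem IsSkew.coord_formMul {f : P →ₗ[k] k} {χ : P →ₐ[k] k} (h : IsSkew f χ) (c : P)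
    (ρ : universalForms k P) : coord f (formMul c ρ : P ⊗[k] P) =
      coord f (ρ : P ⊗[k] P) * invOp χ.toLinearMap c := by
  have key : ∀ t : P ⊗[k] P, coord f (t * (1 ⊗ₜ[k] c)) =
      LinearMap.mul' k P t * invOp f c + coord f t * invOp χ.toLinearMap c := by
    intro t
    induction t with
    | zero => simp
    | add a b ha hb => simp only [add_mul, map_add, ha, hb]; abel
    | tmul a b => simp [h.invOp_mul, mul_add, mul_assoc]
  have hρ : LinearMap.mul' k P (ρ : P ⊗[k] P) = 0 := ρ.2
  refine (key _).trans ?_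
  rw [hρ, zero_mul, zero_add]

/-- The coordinate of 1-forms induced by `coord f`, for a calculus on whose relations it
vanishes. -/
def formCoord (f : P →ₗ[k] k) {N : Submodule P (universalForms k P)}
    (hN : ∀ ρ ∈ N, coord f (ρ : P ⊗[k] P) = 0) : Forms N →ₗ[P] P :=
  N.liftQ (coord f ∘ₗ (universalForms k P).subtype) hN

theorem formCoord_mk (f : P →ₗ[k] k) {N : Submodule P (universalForms k P)}
    (hN : ∀ ρ ∈ N, coord f (ρ : P ⊗[k] P) = 0) (ρ : universalForms k P) :
    formCoord f hN (N.mkQ ρ) = coord f (ρ : P ⊗[k] P) := rfl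

theorem formCoord_diff {f : P →ₗ[k] k} (hf : f 1 = 0) {N : Submodule P (universalForms k P)}
    (hN : ∀ ρ ∈ N, coord f (ρ : P ⊗[k] P) = 0) (v : P) :
    formCoord f hN (diff N v) = invOp f v := by
  change coord f (formOf k P (1 ⊗ₜ v) : P ⊗[k] P) = _
  rw [coord_formOf hf, coord_tmul, one_mul]

theorem formCoord_maurerCartan {f : P →ₗ[k] k} (hf : f 1 = 0)
    {N : Submodule P (universalForms k P)} (hN : ∀ ρ ∈ N, coord f (ρ : P ⊗[k] P) = 0) (u : P) :
    formCoord f hN (maurerCartan N u) = algebraMap k P (f u) := by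
  have key : ∀ t : P ⊗[k] P, formCoord f hN (antipodeD N t) =
      coord f ((HopfAlgebra.antipode k (A := P)).rTensor P t) := by
    intro t
    induction t with
    | zero => simp
    | add a b ha hb => simp only [map_add, ha, hb]
    | tmul x y => rw [antipodeD_tmul, map_smul, formCoord_diff hf]; simp
  have h := coord_kappa f 1 u
  rw [kappa_tmul, one_smul] at h
  rw [maurerCartan, LinearMap.comp_apply, key, h, Algebra.algebraMap_eq_smul_one]

end Frames

/-! ### The coaction along a map of Hopf algebras -/

section Coaction

variable {k : Type*} [Field k] {P : Type*} [Ring P] [HopfAlgebra k P]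
  {A : Type*} [CommRing A] [HopfAlgebra k A] (π : P →ₐ[k] A)

/-- The coaction `(id ⊗ π) Δ` of `A` on `P`. -/
def pushCoaction : P →ₐ[k] P ⊗[k] A :=
  (Algebra.TensorProduct.map (.id k P) π).comp (Bialgebra.comulAlgHom k P)

theorem pushCoaction_apply (v : P) :
    pushCoaction π v = π.toLinearMap.lTensor P (Coalgebra.comul (R := k) v) := rfl

theorem canonicalMap_pushCoaction (t : P ⊗[k] P) : canonicalMap (pushCoaction π) t =
    π.toLinearMap.lTensor P (canonicalMap (Bialgebra.comulAlgHom k P) t) := by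
  induction t with
  | zero => simp
  | add a b ha hb => simp only [map_add, ha, hb]
  | tmul u v =>
    simp only [canonicalMap_tmul, pushCoaction_apply, Bialgebra.comulAlgHom_apply]
    generalize Coalgebra.comul (R := k) v = z
    induction z with
    | zero => simp
    | add a b ha hb => simp only [map_add, smul_add, ha, hb]
    | tmul y z => simp [TensorProduct.smul_tmul']

/-- A quotient map of Hopf algebras `P → A` makes `P` a Galois extension: a preimage of
`u ⊗ π(v)` is `Σ u S(v₍₁₎) ⊗ v₍₂₎`. -/
theorem canonicalMap_pushCoaction_surjective (hπ : Function.Surjective π) :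
    Function.Surjective (canonicalMap (pushCoaction π)) := by
  intro t
  obtain ⟨s, rfl⟩ := LinearMap.lTensor_surjective P (g := π.toLinearMap) hπ t
  exact ⟨kappa k P s, by rw [canonicalMap_pushCoaction, canonicalMap_kappa]⟩

theorem pushCoaction_coassoc
    (hπ : ∀ v, Coalgebra.comul (R := k) (π v) =
      TensorProduct.map π.toLinearMap π.toLinearMap (Coalgebra.comul (R := k) v)) :
    (TensorProduct.assoc k P A A).toLinearMap ∘ₗ (pushCoaction π).toLinearMap.rTensor A ∘ₗ
      (pushCoaction π).toLinearMap =
    (Coalgebra.comul (R := k) (A := A)).lTensor P ∘ₗ (pushCoaction π).toLinearMap := by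
  ext v
  simp only [LinearMap.comp_apply, AlgHom.toLinearMap_apply, LinearEquiv.coe_coe]
  have h1 : ∀ t : P ⊗[k] P, TensorProduct.assoc k P A A ((pushCoaction π).toLinearMap.rTensor A
      (π.toLinearMap.lTensor P t)) =
      (TensorProduct.map π.toLinearMap π.toLinearMap).lTensor P
        (TensorProduct.assoc k P P P ((Coalgebra.comul (R := k)).rTensor P t)) := by
    intro t
    induction t with
    | zero => simp
    | add a b ha hb => simp only [map_add, ha, hb]
    | tmul x y =>
      simp only [LinearMap.lTensor_tmul, LinearMap.rTensor_tmul, AlgHom.toLinearMap_apply,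
        pushCoaction_apply]
      generalize Coalgebra.comul (R := k) x = z
      induction z with
      | zero => simp
      | add a b ha hb => simp only [map_add, TensorProduct.add_tmul, ha, hb]
      | tmul a b => simp
  have h2 : ∀ t : P ⊗[k] P, (Coalgebra.comul (R := k) (A := A)).lTensor P
      (π.toLinearMap.lTensor P t) =
      (TensorProduct.map π.toLinearMap π.toLinearMap).lTensor P
        ((Coalgebra.comul (R := k)).lTensor P t) := by
    intro t
    induction t with
    | zero => simp
    | add a b ha hb => simp only [map_add, ha, hb]
    | tmul x y => simp [hπ]
  rw [pushCoaction_apply, h1, h2, Coalgebra.coassoc_apply]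

theorem pushCoaction_counit
    (hε : ∀ v, Coalgebra.counit (R := k) (π v) = Coalgebra.counit (R := k) v) (v : P) :
    (Coalgebra.counit (R := k) (A := A)).lTensor P (pushCoaction π v) = v ⊗ₜ 1 := by
  have h : Coalgebra.counit (R := k) (A := A) ∘ₗ π.toLinearMap =
      Coalgebra.counit (R := k) (A := P) := LinearMap.ext hε
  rw [pushCoaction_apply, ← LinearMap.comp_apply, ← LinearMap.lTensor_comp, h,
    Coalgebra.lTensor_counit_comul]

/-- The functional `f` is homogeneous of degree `g⁻¹` with respect to the two coactions of `A`
on `P`: `Σ f(v₍₁₎) π(v₍₂₎) = Σ π(v₍₁₎) f(v₍₂₎) g`. -/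
def HomogAt (f : P →ₗ[k] k) (g : A) (v : P) : Prop :=
  TensorProduct.lid k A (TensorProduct.map f π.toLinearMap (Coalgebra.comul (R := k) v)) =
    TensorProduct.rid k A (TensorProduct.map π.toLinearMap f (Coalgebra.comul (R := k) v)) * g

variable {π}

theorem HomogAt.add {f : P →ₗ[k] k} {g : A} {u v : P} (hu : HomogAt π f g u)
    (hv : HomogAt π f g v) : HomogAt π f g (u + v) := by
  simp only [HomogAt, map_add, add_mul] at *
  rw [hu, hv]

theorem HomogAt.algebraMap {f : P →ₗ[k] k} (hf : f 1 = 0) (g : A) (r : k) :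
    HomogAt π f g (algebraMap k P r) := by
  simp [HomogAt, Algebra.algebraMap_eq_smul_one, Algebra.TensorProduct.one_def, hf]

theorem HomogAt.mul {f : P →ₗ[k] k} {χ : P →ₐ[k] k} (h : IsSkew f χ)
    (hχ : ∀ v, HomogAt π χ.toLinearMap 1 v) {g : A} {u v : P}
    (hu : HomogAt π f g u) (hv : HomogAt π f g v) : HomogAt π f g (u * v) := by
  have hl : ∀ s t : P ⊗[k] P,
      TensorProduct.lid k A (TensorProduct.map f π.toLinearMap (s * t)) =
      TensorProduct.lid k A (TensorProduct.map (Coalgebra.counit (R := k)) π.toLinearMap s) *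
        TensorProduct.lid k A (TensorProduct.map f π.toLinearMap t) +
      TensorProduct.lid k A (TensorProduct.map f π.toLinearMap s) *
        TensorProduct.lid k A (TensorProduct.map χ.toLinearMap π.toLinearMap t) := by
    intro s t
    induction s with
    | zero => simp
    | add a b ha hb => simp only [add_mul, map_add, ha, hb]; abel
    | tmul a b =>
      induction t with
      | zero => simp
      | add x y hx hy => simp only [mul_add, map_add, hx, hy]; abel
      | tmul x y => simp [h a x, add_smul, smul_smul, mul_comm]
  have hr : ∀ s t : P ⊗[k] P,
      TensorProduct.rid k A (TensorProduct.map π.toLinearMap f (s * t)) =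
      TensorProduct.rid k A (TensorProduct.map π.toLinearMap (Coalgebra.counit (R := k)) s) *
        TensorProduct.rid k A (TensorProduct.map π.toLinearMap f t) +
      TensorProduct.rid k A (TensorProduct.map π.toLinearMap f s) *
        TensorProduct.rid k A (TensorProduct.map π.toLinearMap χ.toLinearMap t) := by
    intro s t
    induction s with
    | zero => simp
    | add a b ha hb => simp only [add_mul, map_add, ha, hb]; abel
    | tmul a b =>
      induction t with
      | zero => simp
      | add x y hx hy => simp only [mul_add, map_add, hx, hy]; abel
      | tmul x y => simp [h b y, add_smul, smul_smul, mul_comm]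
  have el : TensorProduct.lid k A (TensorProduct.map (Coalgebra.counit (R := k)) π.toLinearMap
      (Coalgebra.comul (R := k) u)) = π u := by
    rw [← LinearMap.lTensor_comp_rTensor, LinearMap.comp_apply, Coalgebra.rTensor_counit_comul]
    simp
  have er : TensorProduct.rid k A (TensorProduct.map π.toLinearMap (Coalgebra.counit (R := k))
      (Coalgebra.comul (R := k) u)) = π u := by
    rw [← LinearMap.rTensor_comp_lTensor, LinearMap.comp_apply, Coalgebra.lTensor_counit_comul]
    simp
  have hχv := hχ v
  simp only [HomogAt, mul_one] at *
  rw [Bialgebra.comul_mul, hl, hr, hu, hv, el, er, hχv]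
  ring

theorem rTensor_invOp_pushCoaction {f : P →ₗ[k] k} {g : A} (hf : ∀ v, HomogAt π f g v) (v : P) :
    (invOp f).rTensor A (pushCoaction π v) = pushCoaction π (invOp f v) * (1 ⊗ₜ g) := by
  have h1 : ∀ t : P ⊗[k] P, (invOp f).rTensor A (π.toLinearMap.lTensor P t) =
      ((TensorProduct.lid k A).toLinearMap ∘ₗ TensorProduct.map f π.toLinearMap).lTensor P
        (TensorProduct.assoc k P P P ((Coalgebra.comul (R := k)).rTensor P t)) := by
    intro t
    induction t with
    | zero => simp
    | add a b ha hb => simp only [map_add, ha, hb]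
    | tmul x y =>
      simp only [LinearMap.lTensor_tmul, LinearMap.rTensor_tmul, AlgHom.toLinearMap_apply, invOp,
        LinearMap.comp_apply, LinearEquiv.coe_coe]
      generalize Coalgebra.comul (R := k) x = z
      induction z with
      | zero => simp
      | add a b ha hb => simp only [map_add, TensorProduct.add_tmul, ha, hb]
      | tmul a b => simp [TensorProduct.smul_tmul]
  have h2 : ∀ t : P ⊗[k] P, π.toLinearMap.lTensor P (Coalgebra.comul (R := k)
      (TensorProduct.rid k P (f.lTensor P t))) =
      ((TensorProduct.rid k A).toLinearMap ∘ₗ TensorProduct.map π.toLinearMap f).lTensor P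
        (TensorProduct.assoc k P P P ((Coalgebra.comul (R := k)).rTensor P t)) := by
    intro t
    induction t with
    | zero => simp
    | add a b ha hb => simp only [map_add, ha, hb]
    | tmul x y =>
      simp only [LinearMap.lTensor_tmul, LinearMap.rTensor_tmul, TensorProduct.rid_tmul, map_smul]
      generalize Coalgebra.comul (R := k) x = z
      induction z with
      | zero => simp
      | add a b ha hb => simp only [map_add, TensorProduct.add_tmul, smul_add, ha, hb]
      | tmul a b => simp
  have h3 : ∀ t : P ⊗[k] P,
      ((TensorProduct.lid k A).toLinearMap ∘ₗ TensorProduct.map f π.toLinearMap).lTensor P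
        ((Coalgebra.comul (R := k)).lTensor P t) =
      ((TensorProduct.rid k A).toLinearMap ∘ₗ TensorProduct.map π.toLinearMap f).lTensor P
        ((Coalgebra.comul (R := k)).lTensor P t) * (1 ⊗ₜ g) := by
    intro t
    induction t with
    | zero => simp
    | add a b ha hb => simp only [map_add, add_mul, ha, hb]
    | tmul x y =>
      simp only [LinearMap.lTensor_tmul, LinearMap.comp_apply, LinearEquiv.coe_coe,
        Algebra.TensorProduct.tmul_mul_tmul, mul_one]
      rw [hf y]
  have h4 : invOp f v = TensorProduct.rid k P (f.lTensor P (Coalgebra.comul (R := k) v)) := rfl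
  rw [pushCoaction_apply, h1, pushCoaction_apply, h4, h2, Coalgebra.coassoc_apply, h3]

theorem rTensor_coord_coactTensor {f : P →ₗ[k] k} {g : A} (hf : ∀ v, HomogAt π f g v)
    (t : P ⊗[k] P) :
    ((coord f).restrictScalars k).rTensor A (coactTensor (pushCoaction π) t) =
      pushCoaction π (coord f t) * (1 ⊗ₜ g) := by
  induction t with
  | zero => simp
  | add a b ha hb => simp only [map_add, add_mul, ha, hb]
  | tmul u v =>
    rw [coord_tmul, map_mul, mul_assoc, ← rTensor_invOp_pushCoaction hf]
    simp only [coactTensor, LinearMap.comp_apply, TensorProduct.map_tmul,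
      AlgHom.toLinearMap_apply, LinearEquiv.coe_coe]
    generalize pushCoaction π u = s
    generalize pushCoaction π v = t
    induction s with
    | zero => simp
    | add a b ha hb => simp only [TensorProduct.add_tmul, map_add, add_mul, ha, hb]
    | tmul a b =>
      induction t with
      | zero => simp
      | add x y hx hy => simp only [TensorProduct.tmul_add, mul_add, map_add, hx, hy]
      | tmul x y => simp

theorem rTensor_coord_coactUniv {f : P →ₗ[k] k} (hf1 : f 1 = 0) {g : A}
    (hf : ∀ v, HomogAt π f g v) (ρ : universalForms k P) :
    ((coord f ∘ₗ (universalForms k P).subtype).restrictScalars k).rTensor A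
        (coactUniv (pushCoaction π) ρ) =
      pushCoaction π (coord f (ρ : P ⊗[k] P)) * (1 ⊗ₜ g) := by
  rw [← rTensor_coord_coactTensor hf]
  rw [coactUniv, LinearMap.comp_apply, LinearMap.comp_apply, ← LinearMap.comp_apply,
    ← LinearMap.rTensor_comp]
  congr 2
  exact LinearMap.ext fun t => coord_formOf hf1 t

/-- A calculus cut out by homogeneous coordinates is covariant under the coaction. -/
theorem coactUniv_mem {ι : Type*} [Fintype ι] {N : Submodule P (universalForms k P)}
    (f : ι → P →ₗ[k] k) (g : ι → A)
    (hN : ∀ ρ, ρ ∈ N ↔ ∀ i, coord (f i) (ρ : P ⊗[k] P) = 0)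
    (hf1 : ∀ i, f i 1 = 0) (hf : ∀ i v, HomogAt π (f i) (g i) v) :
    ∀ ρ ∈ N, coactUniv (pushCoaction π) ρ ∈
      LinearMap.range ((N.subtype.restrictScalars k).rTensor A) := by
  intro ρ hρ
  have := mem_range_rTensor (E := A) (N.restrictScalars k)
    (fun i => (coord (f i) ∘ₗ (universalForms k P).subtype).restrictScalars k) hN
    (x := coactUniv (pushCoaction π) ρ) (by
      intro i
      rw [rTensor_coord_coactUniv (hf1 i) (hf i), (hN ρ).1 hρ i, map_zero, zero_mul])
  exact this

theorem rTensor_formCoord_coactForms {f : P →ₗ[k] k} (hf1 : f 1 = 0) {g : A}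
    (hf : ∀ v, HomogAt π f g v) {N : Submodule P (universalForms k P)}
    (hN : ∀ ρ ∈ N, coord f (ρ : P ⊗[k] P) = 0)
    (h : ∀ ρ ∈ N, coactUniv (pushCoaction π) ρ ∈
      LinearMap.range ((N.subtype.restrictScalars k).rTensor A)) (x : Forms N) :
    ((formCoord f hN).restrictScalars k).rTensor A (coactForms h x) =
      pushCoaction π (formCoord f hN x) * (1 ⊗ₜ g) := by
  obtain ⟨ρ, rfl⟩ := N.mkQ_surjective x
  rw [formCoord_mk, ← rTensor_coord_coactUniv hf1 hf]
  change ((formCoord f hN).restrictScalars k).rTensor A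
    ((N.mkQ.restrictScalars k).rTensor A (coactUniv (pushCoaction π) ρ)) = _
  rw [← LinearMap.comp_apply, ← LinearMap.rTensor_comp]
  rfl

/-- If the vertical direction of a calculus with homogeneous coordinates `f i` is spanned by a form
`w` whose only non-zero coordinate is the one of index `i₀`, then `ρ ↦ F(ρ) w`, with `F` that
coordinate, is a connection. -/
theorem isConnection_of_coord {ι : Type*} [Fintype ι] {N : Submodule P (universalForms k P)}
    {M : Submodule k A} (h : IsQuantumPrincipalBundle (pushCoaction π) N M)
    (f : ι → P →ₗ[k] k) (g : ι → A)
    (hN : ∀ ρ, ρ ∈ N ↔ ∀ i, coord (f i) (ρ : P ⊗[k] P) = 0)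
    (hf1 : ∀ i, f i 1 = 0) (hf : ∀ i v, HomogAt π (f i) (g i) v) (F : ι → Forms N →ₗ[P] P)
    (hF : ∀ i, F i = formCoord (f i) fun ρ hρ => (hN ρ).1 hρ i) (i₀ : ι)
    (hhor : ∀ x, x ∈ horizontal (pushCoaction π) N ↔ F i₀ x = 0) (w : Forms N)
    (hw₀ : F i₀ w = 1) (hw : ∀ i, i ≠ i₀ → F i w = 0) :
    IsConnection h ((LinearMap.toSpanSingleton P _ w) ∘ₗ F i₀) := by
  let Pr : Forms N →ₗ[P] Forms N := (LinearMap.toSpanSingleton P _ w) ∘ₗ F i₀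
  have hPr : ∀ x, Pr x = F i₀ x • w := fun x => rfl
  have hco : ∀ i x, ((F i).restrictScalars k).rTensor A (coactForms h.covariant x) =
      pushCoaction π (F i x) * (1 ⊗ₜ g i) := by
    intro i x
    rw [hF]
    exact rTensor_formCoord_coactForms (hf1 i) (hf i) _ h.covariant x
  have inj : Function.Injective (LinearMap.pi fun i => (F i).restrictScalars k) := by
    rw [injective_iff_map_eq_zero]
    intro x hx
    obtain ⟨ρ, rfl⟩ := N.mkQ_surjective x
    refine (Submodule.Quotient.mk_eq_zero _).2 ((hN ρ).2 fun i => ?_)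
    have := congrFun hx i
    rwa [LinearMap.pi_apply, hF] at this
  have h0 : ∀ x, F i₀ (Pr x) = F i₀ x := fun x => by
    rw [hPr, map_smul, hw₀, smul_eq_mul, mul_one]
  refine ⟨LinearMap.ext fun x => ?_, Submodule.ext fun x => ?_, LinearMap.ext fun x => ?_⟩
  · change Pr (Pr x) = Pr x
    rw [hPr, h0, hPr]
  · change Pr x = 0 ↔ _
    rw [hhor]
    constructor
    · intro hx
      rw [← h0, hx, map_zero]
    · intro hx
      rw [hPr, hx, zero_smul]
  · change coactForms h.covariant (Pr x) =
      (Pr.restrictScalars k).rTensor A (coactForms h.covariant x)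
    apply Module.Flat.rTensor_preserves_injective_linearMap (M := A) _ inj
    rw [← sub_eq_zero, ← map_sub]
    refine rTensor_pi_eq_zero _ fun i => ?_
    rw [map_sub, sub_eq_zero, hco, ← LinearMap.rTensor_comp_apply]
    by_cases hi : i = i₀
    · subst hi
      have h1 : (F i).restrictScalars k ∘ₗ Pr.restrictScalars k = (F i).restrictScalars k :=
        LinearMap.ext h0
      rw [h1, hco, h0]
    · have h2 : ∀ x, F i (Pr x) = 0 := fun x => by rw [hPr, map_smul, hw i hi, smul_zero]
      have h1 : (F i).restrictScalars k ∘ₗ Pr.restrictScalars k = 0 := LinearMap.ext h2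
      rw [h1, h2, map_zero, zero_mul, LinearMap.rTensor_zero, LinearMap.zero_apply]

/-- The Maurer–Cartan form of a coinvariant element `u` is horizontal, since `Δ u ∈ P ⊗ B` for
the algebra `B` of coinvariants. -/
theorem maurerCartan_mem_horizontal
    (N : Submodule P (universalForms k P)) {u : P} (hu : pushCoaction π u = u ⊗ₜ 1) :
    maurerCartan N u ∈ horizontal (pushCoaction π) N := by
  let D : P →ₗ[k] P ⊗[k] A :=
    (pushCoaction π).toLinearMap - (TensorProduct.mk k P A).flip 1
  have hmem : Coalgebra.comul (R := k) u ∈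
      LinearMap.range ((LinearMap.ker D).subtype.lTensor P) := by
    -- Coassociativity gives `(id ⊗ Δ_R) Δ u = (Δ ⊗ id) (u ⊗ 1) = Δ u ⊗ 1`.
    refine mem_range_lTensor (ι := Unit) (LinearMap.ker D) (fun _ => D) (by simp) ?_
    intro _
    have h1 : ∀ t : P ⊗[k] P, (pushCoaction π).toLinearMap.lTensor P t =
        (π.toLinearMap.lTensor P).lTensor P ((Coalgebra.comul (R := k)).lTensor P t) := by
      intro t
      rw [← LinearMap.comp_apply, ← LinearMap.lTensor_comp]
      rfl
    have h2 : ∀ t : P ⊗[k] P, (π.toLinearMap.lTensor P).lTensor P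
        (TensorProduct.assoc k P P P ((Coalgebra.comul (R := k)).rTensor P t)) =
        TensorProduct.assoc k P P A ((Coalgebra.comul (R := k)).rTensor A
          (π.toLinearMap.lTensor P t)) := by
      intro t
      induction t with
      | zero => simp
      | add a b ha hb => simp only [map_add, ha, hb]
      | tmul x y =>
        simp only [LinearMap.lTensor_tmul, LinearMap.rTensor_tmul]
        generalize Coalgebra.comul (R := k) x = z
        induction z with
        | zero => simp
        | add a b ha hb => simp only [map_add, TensorProduct.add_tmul, ha, hb]
        | tmul a b => simp
    have h3 : ∀ t : P ⊗[k] P, ((TensorProduct.mk k P A).flip 1).lTensor P t =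
        TensorProduct.assoc k P P A (t ⊗ₜ 1) := by
      intro t
      induction t with
      | zero => simp
      | add a b ha hb => simp only [map_add, TensorProduct.add_tmul, ha, hb]
      | tmul a b => simp
    rw [LinearMap.lTensor_sub, LinearMap.sub_apply, h1, ← Coalgebra.coassoc_apply, h2, h3,
      ← pushCoaction_apply, hu, LinearMap.rTensor_tmul, sub_self]
  obtain ⟨t, ht⟩ := hmem
  rw [maurerCartan, LinearMap.comp_apply, ← ht]
  clear ht
  induction t with
  | zero => simp
  | add a b ha hb => rw [map_add, map_add]; exact add_mem ha hb
  | tmul a b =>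
    rw [LinearMap.lTensor_tmul, Submodule.subtype_apply, antipodeD_tmul]
    refine Submodule.smul_mem _ _ (Submodule.subset_span ⟨b, 1, sub_eq_zero.1 b.2, ?_⟩)
    have h1 : formMul (1 : P) (univD k P (b : P)) = univD k P (b : P) :=
      Subtype.ext (mul_one (univD k P (b : P) : P ⊗[k] P))
    rw [h1]
    rfl

theorem adR_of_groupLike {a : A}
    (ha : Coalgebra.comul (R := k) a = a ⊗ₜ a) (ha' : Coalgebra.counit (R := k) a = 1) :
    adR k A a = a ⊗ₜ 1 := by
  have h := HopfAlgebra.mul_antipode_rTensor_comul_apply (R := k) a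
  rw [ha, ha', map_one] at h
  simp only [LinearMap.rTensor_tmul, LinearMap.mul'_apply] at h
  simp [adR, ha, h]

end Coaction

/-! ### The quantum tangent space of the 3D calculus -/

section Tangent

variable {k : Type*} [Field k] (q : kˣ)

theorem char_relations (r : kˣ) : SURelations q (r : k) 0 0 ((r⁻¹ : kˣ) : k) := by
  constructor <;> simp

theorem tangent_relations (r : kˣ) (x y z : k) (hy : y = q * r * y) (hz : z = q * r * z) :
    SURelations q !![1, x; 0, (r : k)] !![0, y; 0, 0] !![0, z; 0, 0]
      !![1, -((r⁻¹ : kˣ) : k) * x; 0, ((r⁻¹ : kˣ) : k)] := by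
  have hr : (r : k) ≠ 0 := r.ne_zero
  have hq : (q : k) ≠ 0 := q.ne_zero
  have hy' : y * (r : k)⁻¹ = q * y := by
    field_simp; linear_combination hy
  have hz' : z * (r : k)⁻¹ = q * z := by
    field_simp; linear_combination hz
  constructor <;> ext i j <;> fin_cases i <;> fin_cases j <;>
    simp [Matrix.mul_apply, Fin.sum_univ_two, hr, hy', hz']
  · linear_combination hy
  · linear_combination hz
  · field_simp; ring
  · field_simp; ring

/-- The matrix representations of `SU_q(2)` whose `(0, 1)` entries are the tangent functionals of
the 3D calculus. The representation with index `0` is the vertical one, those with indices `1`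
and `2` correspond to `β` and `γ`. -/
def tangentRep : Fin 3 → (SUq2 q →ₐ[k] Matrix (Fin 2) (Fin 2) k) :=
  ![suLift q (tangent_relations q (q⁻¹ ^ 2) 1 0 0 (by simp) (by simp)),
    suLift q (tangent_relations q q⁻¹ 0 1 0 (by simp) (by simp)),
    suLift q (tangent_relations q q⁻¹ 0 0 1 (by simp) (by simp))]

/-- The characters `α ↦ r`, `δ ↦ r⁻¹`, `β, γ ↦ 0` in the `(1, 1)` entries of `tangentRep`. -/
def tangentChar (i : Fin 3) : SUq2 q →ₐ[k] k :=
  suLift q (char_relations q (![q⁻¹ ^ 2, q⁻¹, q⁻¹] i))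

/-- The tangent functionals of the 3D calculus, `x ↦ f_i(x)` with
`x ≡ ε(x) + f₀(x) (α - 1) + f₁(x) β + f₂(x) γ` modulo the defining right ideal. -/
def tangent (i : Fin 3) : SUq2 q →ₗ[k] k :=
  Matrix.entryLinearMap k k 0 1 ∘ₗ (tangentRep q i).toLinearMap

theorem tangent_apply (i : Fin 3) (x : SUq2 q) : tangent q i x = tangentRep q i x 0 1 := rfl

theorem tangentRep_apply (i : Fin 3) (x : SUq2 q) : tangentRep q i x =
    !![Coalgebra.counit (R := k) x, tangent q i x; 0, tangentChar q i x] := by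
  have key : tangentRep q i x 0 0 = suCounit q x ∧ tangentRep q i x 1 0 = 0 ∧
      tangentRep q i x 1 1 = tangentChar q i x := by
    induction x using su_induction with
    | hs r => simp [Matrix.algebraMap_matrix_apply]
    | hg j =>
      fin_cases i <;> cases j <;> simp [tangentRep, tangentChar, suCounit, genImage]
    | ha x y hx hy => simp [hx, hy]
    | hm x y hx hy => simp [Matrix.mul_apply, Fin.sum_univ_two, hx, hy]
  rw [su_counit_apply, ← key.1, ← key.2.1, ← key.2.2, tangent_apply]
  exact Matrix.eta_fin_two _

theorem tangent_isSkew (i : Fin 3) : IsSkew (tangent q i) (tangentChar q i) := by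
  intro x y
  rw [tangent_apply, map_mul, tangentRep_apply, tangentRep_apply]
  simp [Matrix.mul_apply, Fin.sum_univ_two]

theorem tangent_gen (i : Fin 3) (j : Gen) : tangent q i (gen q j) =
    (![genImage 1 0 0 (-(q : k) ^ 2), genImage 0 1 0 0, genImage 0 0 1 0] :
      Fin 3 → Gen → k) i j := by
  fin_cases i <;> cases j <;> simp [tangent_apply, tangentRep, genImage]

theorem tangentChar_gen (i : Fin 3) (j : Gen) : tangentChar q i (gen q j) =
    (![genImage (((q : k)⁻¹) ^ 2) 0 0 ((q : k) ^ 2), genImage ((q : k)⁻¹) 0 0 (q : k),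
      genImage ((q : k)⁻¹) 0 0 (q : k)] : Fin 3 → Gen → k) i j := by
  fin_cases i <;> cases j <;> simp [tangentChar, genImage]

@[simp]
theorem counit_gen (j : Gen) : Coalgebra.counit (R := k) (gen q j) = genImage (1 : k) 0 0 1 j := by
  rw [su_counit_apply, suCounit, suLift_gen]

theorem mul_mem_ideal3D {x : SUq2 q} (hx : x ∈ ideal3D q) (y : SUq2 q) : x * y ∈ ideal3D q :=
  Submodule.smul_mem (Submodule.span (SUq2 q)ᵐᵒᵖ _) (MulOpposite.op y) hx

/-- Modulo the ideal, each of the generating classes `α - 1`, `β`, `γ` spans a line on which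
`SU_q(2)` acts from the right by a character. -/
theorem mul_sub_smul_mem_ideal3D (χ : SUq2 q →ₐ[k] k) (e : SUq2 q)
    (h : ∀ j, e * gen q j - χ (gen q j) • e ∈ ideal3D q) (y : SUq2 q) :
    e * y - χ y • e ∈ ideal3D q := by
  induction y using su_induction with
  | hs r => simp [← Algebra.commutes r e, ← Algebra.smul_def]
  | hg j => exact h j
  | ha x y hx hy =>
    have := add_mem hx hy
    rw [map_add, add_smul, mul_add]
    convert this using 1
    abel
  | hm x y hx hy =>
    have := add_mem (mul_mem_ideal3D q hx y) ((ideal3D q).smul_mem (χ x) hy)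
    convert this using 1
    rw [map_mul, sub_mul, smul_sub, smul_smul, smul_mul_assoc, mul_assoc]
    abel

theorem gens_mem_ideal3D :
    gen q .d + (q : k) ^ 2 • gen q .a - (1 + (q : k) ^ 2) • 1 ∈ ideal3D q ∧
    gen q .c ^ 2 ∈ ideal3D q ∧ gen q .b * gen q .c ∈ ideal3D q ∧ gen q .b ^ 2 ∈ ideal3D q ∧
    (gen q .a - 1) * gen q .c ∈ ideal3D q ∧ (gen q .a - 1) * gen q .b ∈ ideal3D q := by
  refine ⟨?_, ?_, ?_, ?_, ?_, ?_⟩ <;> exact Submodule.subset_span (by simp)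

theorem span_generator_mem_ideal3D (i : Fin 3) (j : Gen) :
    (![gen q .a - 1, gen q .b, gen q .c] i) * gen q j -
      tangentChar q i (gen q j) • ![gen q .a - 1, gen q .b, gen q .c] i ∈ ideal3D q := by
  obtain ⟨hd, hcc, hbc, hbb, hac, hab⟩ := gens_mem_ideal3D q
  have hq : (q : k) ≠ 0 := q.ne_zero
  have hda := mul_mem_ideal3D q hd (gen q .a)
  have habd := mul_mem_ideal3D q hab (gen q .d)
  have hacd := mul_mem_ideal3D q hac (gen q .d)
  have hbbc := mul_mem_ideal3D q hbb (gen q .c)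
  have hbcc := mul_mem_ideal3D q hbc (gen q .c)
  obtain ⟨ab, ac, -, bc, bd, cd, -⟩ := gen_relations q
  have ad := ad_eq q
  have da := da_eq q
  have eab : gen q .a * gen q .b * gen q .d =
      (q : k) • gen q .b + (q : k) ^ 2 • (gen q .b ^ 2 * gen q .c) := by
    rw [ab, smul_mul_assoc, mul_assoc, ad, mul_add, mul_one, mul_smul_comm, smul_add, smul_smul,
      pow_two, pow_two, mul_assoc]
  have eac : gen q .a * gen q .c * gen q .d =
      (q : k) • gen q .c + (q : k) ^ 2 • (gen q .b * gen q .c * gen q .c) := by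
    rw [ac, smul_mul_assoc, mul_assoc, ad, mul_add, mul_one, mul_smul_comm, smul_add, smul_smul,
      pow_two, ← mul_assoc, ← bc]
  rw [tangentChar_gen]
  fin_cases i <;> cases j <;>
    simp only [Fin.zero_eta, Fin.mk_one, Fin.reduceFinMk, Matrix.cons_val, genImage, zero_smul,
      sub_zero]
  · convert (ideal3D q).smul_mem (((q : k)⁻¹) ^ 2)
      (sub_mem hda ((ideal3D q).smul_mem (q : k)⁻¹ hbc)) using 1
    simp only [sub_mul, add_mul, smul_mul_assoc, one_mul, da]
    match_scalars <;> field_simp <;> ring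
  · exact hab
  · exact hac
  · convert sub_mem ((ideal3D q).smul_mem (q : k) hbc) hd using 1
    rw [sub_mul, one_mul, ad]
    module
  · convert (ideal3D q).smul_mem (q : k)⁻¹ hab using 1
    rw [sub_mul, ab, smul_sub, smul_smul, inv_mul_cancel₀ hq, one_smul, one_mul]
  · rwa [← pow_two]
  · exact hbc
  · convert sub_mem ((ideal3D q).smul_mem ((q : k) ^ 2) hbbc) habd using 1
    rw [sub_mul, sub_mul, eab, one_mul]
    abel
  · convert (ideal3D q).smul_mem (q : k)⁻¹ hac using 1
    rw [sub_mul, ac, smul_sub, smul_smul, inv_mul_cancel₀ hq, one_smul, one_mul]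
  · rwa [← bc]
  · rwa [← pow_two]
  · convert sub_mem ((ideal3D q).smul_mem ((q : k) ^ 2) hbcc) hacd using 1
    rw [sub_mul, sub_mul, eac, one_mul]
    abel

theorem sub_expansion_mem_ideal3D (x : SUq2 q) :
    x - (Coalgebra.counit (R := k) x • 1 +
      ∑ i, tangent q i x • ![gen q .a - 1, gen q .b, gen q .c] i) ∈ ideal3D q := by
  have hmul : ∀ i y, ![gen q .a - 1, gen q .b, gen q .c] i * y -
      tangentChar q i y • ![gen q .a - 1, gen q .b, gen q .c] i ∈ ideal3D q := fun i =>
    mul_sub_smul_mem_ideal3D q _ _ (span_generator_mem_ideal3D q i)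
  have hgen : ∀ j, gen q j - (Coalgebra.counit (R := k) (gen q j) • 1 +
      ∑ i, tangent q i (gen q j) • ![gen q .a - 1, gen q .b, gen q .c] i) ∈ ideal3D q := by
    intro j
    simp only [Fin.sum_univ_three, tangent_gen, counit_gen]
    cases j
    · simp [genImage]
    · simp [genImage]
    · simp [genImage]
    · convert (gens_mem_ideal3D q).1 using 1
      simp only [genImage, Matrix.cons_val]
      module
  generalize ![gen q .a - 1, gen q .b, gen q .c] = e at *
  induction x using su_induction with
  | hs r =>
    have h1 : ∀ i, tangent q i (algebraMap k _ r) = 0 := fun i => by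
      rw [Algebra.algebraMap_eq_smul_one, map_smul, (tangent_isSkew q i).one, smul_zero]
    simp only [h1, zero_smul, Finset.sum_const_zero, add_zero]
    simp [Algebra.algebraMap_eq_smul_one]
  | hg j => exact hgen j
  | ha x y hx hy =>
    convert add_mem hx hy using 1
    simp only [map_add, add_smul, Finset.sum_add_distrib]
    abel
  | hm x y hx hy =>
    have h := add_mem (add_mem (mul_mem_ideal3D q hx y)
      ((ideal3D q).smul_mem (Coalgebra.counit (R := k) x) hy))
      (sum_mem (t := Finset.univ) fun i _ => (ideal3D q).smul_mem (tangent q i x) (hmul i y))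
    convert h using 1
    simp only [tangent_isSkew q _ x y, Bialgebra.counit_mul, sub_mul, add_mul, Finset.sum_mul,
      smul_mul_assoc, one_mul, smul_sub, smul_add, Finset.smul_sum, smul_smul, add_smul,
      Finset.sum_add_distrib, Finset.sum_sub_distrib]
    abel

/-- The right ideal of the 3D calculus is the common kernel of the counit and the tangent
functionals. -/
theorem mem_ideal3D_iff (x : SUq2 q) : x ∈ ideal3D q ↔
    Coalgebra.counit (R := k) x = 0 ∧ ∀ i, tangent q i x = 0 := by
  constructor
  · intro hx
    have hx' : x ∈ Submodule.span (SUq2 q)ᵐᵒᵖ _ := hx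
    clear hx
    induction hx' using Submodule.span_induction with
    | mem x h =>
      have hskew := fun i => tangent_isSkew q i
      obtain rfl | rfl | rfl | rfl | rfl | rfl := h
      all_goals
        refine ⟨?_, fun i => ?_⟩
        · simp [genImage]
        · simp only [map_sub, map_add, map_smul, (hskew i).one, pow_two, hskew i _ _, sub_mul,
            one_mul, counit_gen, tangent_gen, tangentChar_gen]
          fin_cases i <;> simp [genImage]
    | zero => simp
    | add x y _ _ hx hy => simp [hx.1, hy.1, hx.2, hy.2]
    | smul y x _ hx =>
      obtain ⟨y, rfl⟩ := MulOpposite.op_surjective y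
      rw [op_smul_eq_mul]
      exact ⟨by simp [hx.1], fun i => by rw [tangent_isSkew q i x y, hx.1, hx.2 i]; simp⟩
  · rintro ⟨h0, h⟩
    simpa [h0, h] using sub_expansion_mem_ideal3D q x

theorem mem_calculusSU_iff (ρ : universalForms k (SUq2 q)) : ρ ∈ calculusSU q ↔
    ∀ i, coord (tangent q i) (ρ : SUq2 q ⊗[k] SUq2 q) = 0 :=
  mem_leftCovariant_iff _ (mem_ideal3D_iff q) ρ

end Tangent

/-! ### The calculus on `SO_q(3)` and the projection to the fibre -/

section Monopole

open LaurentPolynomial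

variable {k : Type*} [Field k] (q : kˣ)

/-- The restriction of a tangent functional to `SO_q(3)`. -/
def tangentSO (i : Fin 3) : SOq3 q →ₗ[k] k := tangent q i ∘ₗ (SOq3 q).val.toLinearMap

theorem tangentSO_apply (i : Fin 3) (x : SOq3 q) : tangentSO q i x = tangent q i x := rfl

theorem comul_coe (x : SOq3 q) : Coalgebra.comul (R := k) (x : SUq2 q) =
    TensorProduct.map (SOq3 q).val.toLinearMap (SOq3 q).val.toLinearMap
      (Coalgebra.comul (R := k) x) :=
  (map_subComul (SOq3 q) (isHopfSubalgebra_SOq3 q) x).symm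

theorem counit_coe (x : SOq3 q) :
    Coalgebra.counit (R := k) x = Coalgebra.counit (R := k) (x : SUq2 q) := rfl

theorem tangentSO_isSkew (i : Fin 3) :
    IsSkew (tangentSO q i) ((tangentChar q i).comp (SOq3 q).val) :=
  fun x y => tangent_isSkew q i x y

theorem coe_invOp (f : SUq2 q →ₗ[k] k) (x : SOq3 q) :
    (invOp (f ∘ₗ (SOq3 q).val.toLinearMap) x : SUq2 q) = invOp f x := by
  simp only [invOp, LinearMap.comp_apply, LinearEquiv.coe_coe, comul_coe]
  generalize Coalgebra.comul (R := k) x = t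
  induction t with
  | zero => simp
  | add a b ha hb => simp only [map_add, Subalgebra.coe_add, ha, hb]
  | tmul a b => simp

theorem coe_coord (f : SUq2 q →ₗ[k] k) (t : SOq3 q ⊗[k] SOq3 q) :
    (coord (f ∘ₗ (SOq3 q).val.toLinearMap) t : SUq2 q) =
      coord f (TensorProduct.map (SOq3 q).val.toLinearMap (SOq3 q).val.toLinearMap t) := by
  induction t with
  | zero => simp
  | add a b ha hb => simp only [map_add, Subalgebra.coe_add, ha, hb]
  | tmul a b => simp [coe_invOp]

theorem mem_calculusSO_iff (ρ : universalForms k (SOq3 q)) : ρ ∈ calculusSO q ↔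
    ∀ i, coord (tangentSO q i) (ρ : SOq3 q ⊗[k] SOq3 q) = 0 := by
  refine (mem_calculusSU_iff q (mapUniv (SOq3 q).val ρ)).trans (forall_congr' fun i => ?_)
  rw [← Subtype.val_injective.eq_iff, tangentSO, coe_coord]
  rfl

/-- The coordinates of the 1-forms on `SO_q(3)`. -/
def formSO (i : Fin 3) : Forms (calculusSO q) →ₗ[SOq3 q] SOq3 q :=
  formCoord (tangentSO q i) fun ρ hρ => (mem_calculusSO_iff q ρ).1 hρ i

/-- The coordinates of the 1-forms on `SU_q(2)`. -/
def formSU (i : Fin 3) : Forms (calculusSU q) →ₗ[SUq2 q] SUq2 q :=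
  formCoord (tangent q i) fun ρ hρ => (mem_calculusSU_iff q ρ).1 hρ i

theorem formSO_ext {x y : Forms (calculusSO q)} (h : ∀ i, formSO q i x = formSO q i y) :
    x = y := by
  rw [← sub_eq_zero]
  obtain ⟨ρ, hρ⟩ := (calculusSO q).mkQ_surjective (x - y)
  rw [← hρ]
  refine (Submodule.Quotient.mk_eq_zero _).2 ((mem_calculusSO_iff q ρ).2 fun i => ?_)
  have := h i
  rw [← sub_eq_zero, ← map_sub, ← hρ] at this
  exact this

theorem formSU_ext {x y : Forms (calculusSU q)} (h : ∀ i, formSU q i x = formSU q i y) :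
    x = y := by
  rw [← sub_eq_zero]
  obtain ⟨ρ, hρ⟩ := (calculusSU q).mkQ_surjective (x - y)
  rw [← hρ]
  refine (Submodule.Quotient.mk_eq_zero _).2 ((mem_calculusSU_iff q ρ).2 fun i => ?_)
  have := h i
  rw [← sub_eq_zero, ← map_sub, ← hρ] at this
  exact this

theorem formSU_formsMap (i : Fin 3) (x : Forms (calculusSO q)) :
    formSU q i (formsMap (SOq3 q).val (calculusSU q) x) = formSO q i x := by
  obtain ⟨ρ, rfl⟩ := (calculusSO q).mkQ_surjective x
  exact (coe_coord q (tangent q i) ρ).symm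

theorem formSO_maurerCartan (i : Fin 3) (u : SOq3 q) :
    formSO q i (maurerCartan (calculusSO q) u) = algebraMap k _ (tangent q i u) :=
  formCoord_maurerCartan (tangentSO_isSkew q i).one _ u

theorem piSU_gen (j : Gen) : piSU q (gen q j) = genImage (T 1 : k[T;T⁻¹]) 0 0 (T (-1)) j :=
  suLift_gen q _ j

theorem comul_piSU (v : SUq2 q) : Coalgebra.comul (R := k) (piSU q v) =
    TensorProduct.map (piSU q).toLinearMap (piSU q).toLinearMap (Coalgebra.comul (R := k) v) := by
  have h : (Bialgebra.comulAlgHom k k[T;T⁻¹]).comp (piSU q) =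
      (Algebra.TensorProduct.map (piSU q) (piSU q)).comp (suComul q) := by
    apply su_hom_ext
    intro j
    cases j <;> simp [piSU_gen, suComul, genImage]
  exact DFunLike.congr_fun h v

theorem counit_piSU (v : SUq2 q) :
    Coalgebra.counit (R := k) (piSU q v) = Coalgebra.counit (R := k) v := by
  have h : (Bialgebra.counitAlgHom k k[T;T⁻¹]).comp (piSU q) = suCounit q := by
    apply su_hom_ext
    intro j
    cases j <;> simp [piSU_gen, suCounit, genImage]
  exact DFunLike.congr_fun h v

theorem laurent_linear_ext {V : Type*} [AddCommGroup V] [Module k V]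
    {f g : k[T;T⁻¹] →ₗ[k] V} (h : ∀ n : ℤ, f (T n) = g (T n)) : f = g := by
  refine LinearMap.ext fun p => ?_
  induction p using LaurentPolynomial.induction_on' with
  | add p q hp hq => rw [map_add, map_add, hp, hq]
  | C_mul_T n a => rw [← smul_eq_C_mul, map_smul, map_smul, h]

theorem comul_sqIncl (f : k[T;T⁻¹]) : Coalgebra.comul (R := k) (sqIncl f) =
    TensorProduct.map (sqIncl (k := k)).toLinearMap (sqIncl (k := k)).toLinearMap
      (Coalgebra.comul (R := k) f) := by
  have h : Coalgebra.comul (R := k) ∘ₗ (sqIncl (k := k)).toLinearMap =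
      TensorProduct.map (sqIncl (k := k)).toLinearMap (sqIncl (k := k)).toLinearMap ∘ₗ
        Coalgebra.comul (R := k) := by
    apply laurent_linear_ext
    intro n
    simp [sqIncl_T]
  exact DFunLike.congr_fun h f

theorem counit_sqIncl (f : k[T;T⁻¹]) : Coalgebra.counit (R := k) (sqIncl f) =
    Coalgebra.counit (R := k) f := by
  have h : Coalgebra.counit (R := k) ∘ₗ (sqIncl (k := k)).toLinearMap =
        Coalgebra.counit (R := k) := by
    apply laurent_linear_ext
    intro n
    simp [sqIncl_T]
  exact DFunLike.congr_fun h f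

theorem counit_piSO (v : SOq3 q) :
    Coalgebra.counit (R := k) (piSO q v) = Coalgebra.counit (R := k) v := by
  rw [← counit_sqIncl, sqIncl_piSO, counit_piSU, counit_coe]

theorem comul_piSO (v : SOq3 q) : Coalgebra.comul (R := k) (piSO q v) =
    TensorProduct.map (piSO q).toLinearMap (piSO q).toLinearMap (Coalgebra.comul (R := k) v) := by
  have inj := TensorProduct.map_injective_of_flat_flat (sqIncl (k := k)).toLinearMap
    (sqIncl (k := k)).toLinearMap sqIncl_injective sqIncl_injective
  apply inj
  rw [← comul_sqIncl, sqIncl_piSO, comul_piSU, comul_coe]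
  have h : (sqIncl (k := k)).toLinearMap ∘ₗ (piSO q).toLinearMap =
      (piSU q).toLinearMap ∘ₗ (SOq3 q).val.toLinearMap := LinearMap.ext (sqIncl_piSO q)
  rw [TensorProduct.map_map, TensorProduct.map_map, h]

/-- The product of two generators, as an element of `SO_q(3)`. -/
def genMul (i j : Gen) : SOq3 q := ⟨gen q i * gen q j, Algebra.subset_adjoin ⟨i, j, rfl⟩⟩

theorem coe_genMul (i j : Gen) : (genMul q i j : SUq2 q) = gen q i * gen q j := rfl

theorem piSO_aa : piSO q (genMul q .a .a) = T 1 := by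
  apply sqIncl_injective
  rw [sqIncl_piSO, coe_genMul, map_mul, piSU_gen, sqIncl_T, genImage, ← T_add]
  rfl

theorem piSO_dd : piSO q (genMul q .d .d) = T (-1) := by
  apply sqIncl_injective
  rw [sqIncl_piSO, coe_genMul, map_mul, piSU_gen, sqIncl_T, genImage, ← T_add]
  rfl

/-- Every Laurent polynomial is the image of a polynomial in `α²` and `δ²`, which is killed by
the functionals `f₁` and `f₂`. -/
theorem exists_piSO_eq (f : k[T;T⁻¹]) : ∃ x : SOq3 q, piSO q x = f ∧
    tangent q 1 x = 0 ∧ tangent q 2 x = 0 := by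
  have hmul : ∀ x y : SOq3 q, (tangent q 1 x = 0 ∧ tangent q 2 x = 0) →
      (tangent q 1 y = 0 ∧ tangent q 2 y = 0) →
      (tangent q 1 (x * y : SOq3 q) = 0 ∧ tangent q 2 (x * y : SOq3 q) = 0) := by
    rintro x y ⟨h1, h2⟩ ⟨h3, h4⟩
    rw [Subalgebra.coe_mul, tangent_isSkew q 1 x, tangent_isSkew q 2 x, h1, h2, h3, h4]
    simp
  have hone : tangent q 1 ((1 : SOq3 q) : SUq2 q) = 0 ∧ tangent q 2 ((1 : SOq3 q) : SUq2 q) = 0 :=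
    ⟨(tangent_isSkew q 1).one, (tangent_isSkew q 2).one⟩
  have hgen : ∀ i, (i = Gen.a ∨ i = Gen.d) → tangent q 1 (genMul q i i : SUq2 q) = 0 ∧
      tangent q 2 (genMul q i i : SUq2 q) = 0 := by
    rintro i (rfl | rfl) <;>
      simp [coe_genMul, tangent_isSkew q _ (gen q _) (gen q _), tangent_gen, genImage]
  have hpow : ∀ (x : SOq3 q) (n : ℕ), (tangent q 1 x = 0 ∧ tangent q 2 x = 0) →
      (tangent q 1 (x ^ n : SOq3 q) = 0 ∧ tangent q 2 (x ^ n : SOq3 q) = 0) := by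
    intro x n hx
    induction n with
    | zero => rw [pow_zero]; exact hone
    | succ n ih => rw [pow_succ]; exact hmul _ _ ih hx
  induction f using LaurentPolynomial.induction_on' with
  | add f g hf hg =>
    obtain ⟨x, rfl, h1, h2⟩ := hf
    obtain ⟨y, rfl, h3, h4⟩ := hg
    exact ⟨x + y, map_add _ _ _, by rw [Subalgebra.coe_add, map_add, h1, h3, add_zero],
      by rw [Subalgebra.coe_add, map_add, h2, h4, add_zero]⟩
  | C_mul_T n r =>
    obtain ⟨y, hy, h1, h2⟩ : ∃ x : SOq3 q, piSO q x = T n ∧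
        tangent q 1 x = 0 ∧ tangent q 2 x = 0 := by
      obtain ⟨m, rfl | rfl⟩ := n.eq_nat_or_neg
      · exact ⟨genMul q .a .a ^ m, by rw [map_pow, piSO_aa, T_pow, mul_one],
          hpow _ _ (hgen _ (.inl rfl))⟩
      · exact ⟨genMul q .d .d ^ m, by rw [map_pow, piSO_dd, T_pow, mul_neg, mul_one],
          hpow _ _ (hgen _ (.inr rfl))⟩
    exact ⟨r • y, by rw [map_smul, hy, smul_eq_C_mul],
      by rw [Subalgebra.coe_smul, map_smul, h1, smul_zero],
      by rw [Subalgebra.coe_smul, map_smul, h2, smul_zero]⟩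

theorem piSO_surjective : Function.Surjective (piSO q) := fun f =>
  let ⟨x, hx, _⟩ := exists_piSO_eq q f
  ⟨x, hx⟩

theorem monopoleCoaction_eq : monopoleCoaction q = pushCoaction (piSO q) := rfl

/-! ### Homogeneity of the tangent functionals -/

theorem homogAt_tangentChar (i : Fin 3) (v : SUq2 q) :
    HomogAt (piSU q) (tangentChar q i).toLinearMap 1 v := by
  have h : (Algebra.TensorProduct.lid k k[T;T⁻¹]).toAlgHom.comp
      ((Algebra.TensorProduct.map (tangentChar q i) (piSU q)).comp (suComul q)) =
      (Algebra.TensorProduct.rid k k k[T;T⁻¹]).toAlgHom.comp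
      ((Algebra.TensorProduct.map (piSU q) (tangentChar q i)).comp (suComul q)) := by
    apply su_hom_ext
    intro j
    fin_cases i <;> cases j <;> simp [suComul, genImage, piSU_gen, tangentChar_gen]
  have h' := DFunLike.congr_fun h v
  simp only [HomogAt, mul_one]
  exact h'

/-- The functionals `f₀, f₁, f₂` have degrees `0, 2, -2`, counted in powers of `Z^{1/2}`. -/
theorem homogAt_tangent (i : Fin 3) (v : SUq2 q) :
    HomogAt (piSU q) (tangent q i) (T (![0, -2, 2] i)) v := by
  induction v using su_induction with
  | hs r => exact HomogAt.algebraMap (tangent_isSkew q i).one _ r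
  | hg j =>
    have e1 : (T 1 * T (-2) : k[T;T⁻¹]) = T (-1) := by rw [← T_add]; rfl
    have e2 : (T (-1) * T 2 : k[T;T⁻¹]) = T 1 := by rw [← T_add]; rfl
    rw [HomogAt, su_comul_apply, suComul, suLift_gen]
    fin_cases i <;> cases j <;> simp [genImage, piSU_gen, tangent_gen, e1, e2]
  | ha x y hx hy => exact hx.add hy
  | hm x y hx hy => exact hx.mul (tangent_isSkew q i) (homogAt_tangentChar q i) hy

theorem homogAt_tangentSO (i : Fin 3) (v : SOq3 q) :
    HomogAt (piSO q) (tangentSO q i) (T (![0, -1, 1] i)) v := by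
  have hT : (sqIncl (T (![0, -1, 1] i)) : k[T;T⁻¹]) = T (![0, -2, 2] i) := by
    rw [sqIncl_T]
    fin_cases i <;> rfl
  have h := homogAt_tangent q i v
  rw [HomogAt, comul_coe] at h
  apply sqIncl_injective
  rw [map_mul, hT]
  have hl : ∀ t : SOq3 q ⊗[k] SOq3 q, sqIncl (TensorProduct.lid k _
      (TensorProduct.map (tangentSO q i) (piSO q).toLinearMap t)) =
      TensorProduct.lid k _ (TensorProduct.map (tangent q i) (piSU q).toLinearMap
        (TensorProduct.map (SOq3 q).val.toLinearMap (SOq3 q).val.toLinearMap t)) := by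
    intro t
    induction t with
    | zero => simp
    | add a b ha hb => simp only [map_add, ha, hb]
    | tmul a b => simp [sqIncl_piSO, tangentSO_apply]
  have hr : ∀ t : SOq3 q ⊗[k] SOq3 q, sqIncl (TensorProduct.rid k _
      (TensorProduct.map (piSO q).toLinearMap (tangentSO q i) t)) =
      TensorProduct.rid k _ (TensorProduct.map (piSU q).toLinearMap (tangent q i)
        (TensorProduct.map (SOq3 q).val.toLinearMap (SOq3 q).val.toLinearMap t)) := by
    intro t
    induction t with
    | zero => simp
    | add a b ha hb => simp only [map_add, ha, hb]
    | tmul a b => simp [sqIncl_piSO, tangentSO_apply]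
  rw [hl, hr, h]

/-! ### The tangent functional of the fibre -/

theorem laurent_algHom_ext {B : Type*} [Ring B] [Algebra k B] {f g : k[T;T⁻¹] →ₐ[k] B}
    (h : f (T 1) = g (T 1)) : f = g := by
  exact AddMonoidAlgebra.algHom_ext' (MonoidHom.ext_mint h) (Subsingleton.elim _ _)

theorem tangentRep_gen_b_mul_gen_c (i : Fin 3) :
    tangentRep q i (gen q .b * gen q .c) = 0 := by
  rw [tangentRep_apply, Bialgebra.counit_mul, tangent_isSkew q i _ _, map_mul]
  ext m n
  fin_cases i <;> fin_cases m <;> fin_cases n <;> simp [tangentChar_gen, tangent_gen, genImage]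

/-- The matrix by which `α` acts in the representation `tangentRep q i`, with inverse the matrix
of `δ`. -/
def alphaMatrix (i : Fin 3) : (Matrix (Fin 2) (Fin 2) k)ˣ where
  val := tangentRep q i (gen q .a)
  inv := tangentRep q i (gen q .d)
  val_inv := by
    rw [← map_mul, ad_eq, map_add, map_smul, tangentRep_gen_b_mul_gen_c, map_one,
      smul_zero, add_zero]
  inv_val := by
    rw [← map_mul, da_eq, map_add, map_smul, tangentRep_gen_b_mul_gen_c, map_one,
      smul_zero, add_zero]

/-- The tangent functional of the inherited calculus on the fibre `k[Z, Z⁻¹]`. -/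
def fibreTangent : k[T;T⁻¹] →ₗ[k] k :=
  Matrix.entryLinearMap k k 0 1 ∘ₗ (laurentLift (alphaMatrix q 0 ^ 2)).toLinearMap

theorem fibreTangent_apply (f : k[T;T⁻¹]) :
    fibreTangent q f =
      (laurentLift (alphaMatrix q 0 ^ 2) f : Matrix (Fin 2) (Fin 2) k) 0 1 := rfl

theorem laurentLift_sq {B : Type*} [Ring B] [Algebra k B] (u : Bˣ) (f : k[T;T⁻¹]) :
    laurentLift (u ^ 2) f = laurentLift u (sqIncl f) := by
  have h : laurentLift (k := k) (u ^ 2) = (laurentLift u).comp sqIncl := by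
    apply laurent_algHom_ext
    rw [AlgHom.comp_apply, sqIncl_T, laurentLift_T, laurentLift_T, zpow_one]
    rfl
  exact DFunLike.congr_fun h f

/-- The vertical representation factors through the projection to the fibre. -/
theorem laurentLift_alphaMatrix_piSU (x : SUq2 q) :
    laurentLift (alphaMatrix q 0) (piSU q x) = tangentRep q 0 x := by
  have h : (laurentLift (alphaMatrix q 0)).comp (piSU q) = tangentRep q 0 := by
    apply su_hom_ext
    intro j
    cases j
    · simp [piSU_gen, genImage, laurentLift_T, alphaMatrix]
    · simp [piSU_gen, genImage, tangentRep, ← Matrix.ext_iff]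
    · simp [piSU_gen, genImage, tangentRep, ← Matrix.ext_iff]
    · simp [piSU_gen, genImage, laurentLift_T, alphaMatrix]
  exact DFunLike.congr_fun h x

theorem fibreTangent_piSO (x : SOq3 q) : fibreTangent q (piSO q x) = tangentSO q 0 x := by
  rw [fibreTangent_apply, laurentLift_sq, sqIncl_piSO, laurentLift_alphaMatrix_piSU]
  rfl

theorem fibreTangent_one : fibreTangent q 1 = 0 := by
  simp [fibreTangent_apply]

theorem mem_idealA_iff (f : k[T;T⁻¹]) : f ∈ idealA q ↔
    Coalgebra.counit (R := k) f = 0 ∧ fibreTangent q f = 0 := by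
  constructor
  · rintro ⟨x, hx, rfl⟩
    have hx' := (mem_ideal3D_iff q _).1 hx
    exact ⟨(counit_piSO q x).trans hx'.1, (fibreTangent_piSO q x).trans (hx'.2 0)⟩
  · rintro ⟨h0, h⟩
    obtain ⟨x, rfl, h1, h2⟩ := exists_piSO_eq q f
    refine ⟨x, (mem_ideal3D_iff q _).2 ⟨(counit_piSO q x).symm.trans h0, ?_⟩, rfl⟩
    rw [fibreTangent_piSO] at h
    intro i
    fin_cases i
    exacts [h, h1, h2]

/-- `[n]_x` for an integer `n`, with the limiting value `n` at `x = 1`. -/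
def intQNumber (x : k) (n : ℤ) : k :=
  open Classical in if x = 1 then (n : k) else (x ^ n - 1) / (x - 1)

theorem intQNumber_succ {x : k} (hx : x ≠ 0) (n : ℤ) :
    intQNumber x (n + 1) = 1 + intQNumber x n * x := by
  unfold intQNumber
  split_ifs with h
  · rw [h]; push_cast; ring
  · have : x - 1 ≠ 0 := sub_ne_zero.2 h
    rw [zpow_add₀ hx]
    field_simp
    ring

theorem alphaMatrix_sq : ((alphaMatrix q 0 ^ 2 : (Matrix (Fin 2) (Fin 2) k)ˣ) :
    Matrix (Fin 2) (Fin 2) k) = !![1, 1 + ((q : k)⁻¹) ^ 2; 0, ((q : k)⁻¹) ^ 4] := by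
  rw [Units.val_pow_eq_pow_val, pow_two]
  ext i j
  fin_cases i <;> fin_cases j <;>
    simp [alphaMatrix, tangentRep, genImage, Matrix.mul_apply, Fin.sum_univ_two]
  ring

theorem alphaMatrix_sq_zpow (n : ℤ) : (((alphaMatrix q 0 ^ 2) ^ n :
    (Matrix (Fin 2) (Fin 2) k)ˣ) : Matrix (Fin 2) (Fin 2) k) =
      !![1, (1 + ((q : k)⁻¹) ^ 2) * intQNumber (((q : k)⁻¹) ^ 4) n; 0, (((q : k)⁻¹) ^ 4) ^ n] := by
  have hx : ((q : k)⁻¹) ^ 4 ≠ 0 := pow_ne_zero _ (inv_ne_zero q.ne_zero)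
  have hstep : ∀ n : ℤ, !![1, (1 + ((q : k)⁻¹) ^ 2) * intQNumber (((q : k)⁻¹) ^ 4) n; 0,
      (((q : k)⁻¹) ^ 4) ^ n] * ((alphaMatrix q 0 ^ 2 : (Matrix (Fin 2) (Fin 2) k)ˣ) :
        Matrix (Fin 2) (Fin 2) k) =
      !![1, (1 + ((q : k)⁻¹) ^ 2) * intQNumber (((q : k)⁻¹) ^ 4) (n + 1); 0,
        (((q : k)⁻¹) ^ 4) ^ (n + 1)] := by
    intro n
    rw [alphaMatrix_sq, intQNumber_succ hx, zpow_add_one₀ hx]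
    ext i j
    fin_cases i <;> fin_cases j <;> simp [Matrix.mul_apply, Fin.sum_univ_two]
    ring
  induction n with
  | zero =>
    ext i j
    fin_cases i <;> fin_cases j <;> simp [intQNumber]
  | succ n ih => rw [zpow_add_one, Units.val_mul, ih, hstep]
  | pred n ih =>
    rw [zpow_sub_one, Units.val_mul, ih, Units.mul_inv_eq_iff_eq_mul, hstep, sub_add_cancel]

theorem fibreTangent_T (n : ℤ) : fibreTangent q (T n) =
    (1 + ((q : k)⁻¹) ^ 2) * intQNumber (((q : k)⁻¹) ^ 4) n := by
  rw [fibreTangent_apply, laurentLift_T, alphaMatrix_sq_zpow]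
  rfl

theorem rescale_add (x : k) (f g : k[T;T⁻¹]) : rescale x (f + g) = rescale x f + rescale x g := by
  rw [rescale, AddMonoidAlgebra.coeff_add, Finsupp.sum_add_index']
  · rfl
  · simp
  · intro n a b
    rw [add_mul, map_add, add_mul]

theorem jackson_add (x : k) (f g : k[T;T⁻¹]) : jackson x (f + g) = jackson x f + jackson x g := by
  unfold jackson
  split_ifs
  · rw [AddMonoidAlgebra.coeff_add, Finsupp.sum_add_index']
    · simp
    · intro n a b
      rw [add_mul, map_add, add_mul]
  · rw [rescale_add]
    ring

theorem evalOne_jackson_C_mul_T (x r : k) (n : ℤ) :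
    evalOne (jackson x (C r * T n)) = r * intQNumber x n := by
  unfold jackson intQNumber rescale
  rw [← single_eq_C_mul_T, AddMonoidAlgebra.coeff_single]
  split_ifs
  · rw [Finsupp.sum_single_index (by simp)]
    simp [evalOne]
  · rw [Finsupp.sum_single_index (by simp), single_eq_C_mul_T]
    simp [evalOne]
    ring

theorem fibreTangent_eq_jackson (f : k[T;T⁻¹]) :
    fibreTangent q f = qNumber ((q : k) ^ (-2 : ℤ)) 2 *
      evalOne (jackson ((q : k) ^ (-4 : ℤ)) f) := by
  have h4 : (q : k) ^ (-4 : ℤ) = ((q : k)⁻¹) ^ 4 := by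
    rw [inv_pow, ← zpow_natCast, ← zpow_neg]; rfl
  have h2 : (q : k) ^ (-2 : ℤ) = ((q : k)⁻¹) ^ 2 := by
    rw [inv_pow, ← zpow_natCast, ← zpow_neg]; rfl
  have hn : qNumber (((q : k)⁻¹) ^ 2) 2 = 1 + ((q : k)⁻¹) ^ 2 := by
    unfold qNumber
    split_ifs with h
    · rw [h]; norm_num
    · rw [div_eq_iff (sub_ne_zero.2 h)]; ring
  rw [h4, h2, hn]
  induction f using LaurentPolynomial.induction_on' with
  | add f g hf hg =>
    rw [map_add, jackson_add, hf, hg, evalOne, evalOne, evalOne, map_add]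
    ring
  | C_mul_T n r =>
    rw [evalOne_jackson_C_mul_T, ← smul_eq_C_mul, map_smul, fibreTangent_T, smul_eq_mul]
    ring

end Monopole

/-! ### The bundle and its connection -/

section Bundle

open LaurentPolynomial

variable {k : Type*} [Field k] (q : kˣ)

theorem adR_laurent (f : k[T;T⁻¹]) : adR k k[T;T⁻¹] f = f ⊗ₜ 1 := by
  have h : adR k k[T;T⁻¹] = (TensorProduct.mk k k[T;T⁻¹] k[T;T⁻¹]).flip 1 :=
    laurent_linear_ext fun n => adR_of_groupLike (comul_T n) (counit_T n)
  exact DFunLike.congr_fun h f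

theorem isBicovariantIdeal_idealA : IsBicovariantIdeal k (idealA q) where
  le_augmentation f hf := ((mem_idealA_iff q f).1 hf).1
  mul_mem := by
    rintro _ ⟨x, hx, rfl⟩ b
    obtain ⟨y, rfl⟩ := piSO_surjective q b
    exact ⟨x * y, mul_mem_ideal3D q hx y, map_mul (piSO q) x y⟩
  adR_mem f hf := ⟨⟨f, hf⟩ ⊗ₜ 1, by rw [adR_laurent]; rfl⟩

/-- The injective functional on `ker ε / M_A` induced by the tangent functional of the fibre. -/
def invCoord : InvForms (idealA q) →ₗ[k] k :=
  ((idealA q).comap (augmentation k k[T;T⁻¹]).subtype).liftQ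
    (fibreTangent q ∘ₗ (augmentation k k[T;T⁻¹]).subtype)
    fun f hf => ((mem_idealA_iff q f).1 hf).2

theorem invCoord_piA (f : k[T;T⁻¹]) : invCoord q (piA (idealA q) f) = fibreTangent q f := by
  change fibreTangent q (f - algebraMap k _ (Coalgebra.counit (R := k) f)) = _
  rw [map_sub, Algebra.algebraMap_eq_smul_one, map_smul, fibreTangent_one, smul_zero, sub_zero]

theorem invCoord_injective : Function.Injective (invCoord q) := by
  rw [injective_iff_map_eq_zero]
  intro x hx
  obtain ⟨f, rfl⟩ := Submodule.Quotient.mk_surjective _ x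
  exact (Submodule.Quotient.mk_eq_zero _).2 ((mem_idealA_iff q f).2 ⟨f.2, hx⟩)

theorem coord_tangentSO_zero (t : SOq3 q ⊗[k] SOq3 q) : coord (tangentSO q 0) t =
    TensorProduct.rid k _ ((fibreTangent q).lTensor _ (canonicalMap (monopoleCoaction q) t)) := by
  have h : fibreTangent q ∘ₗ (piSO q).toLinearMap = tangentSO q 0 :=
    LinearMap.ext (fibreTangent_piSO q)
  rw [coord_eq, monopoleCoaction_eq, canonicalMap_pushCoaction, ← LinearMap.comp_apply,
    ← LinearMap.lTensor_comp, h]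

theorem tilde_mem (ρ : universalForms k (SOq3 q)) (hρ : ρ ∈ calculusSO q) :
    tilde (monopoleCoaction q) ρ ∈ LinearMap.range ((idealA q).subtype.lTensor (SOq3 q)) := by
  refine mem_range_lTensor (ι := Bool) (idealA q)
    (fun i => cond i (Coalgebra.counit (R := k)) (fibreTangent q)) ?_ ?_
  · intro f
    rw [mem_idealA_iff, Bool.forall_bool, and_comm]
    rfl
  · have h0 : (Coalgebra.counit (R := k)) ∘ₗ (piSO q).toLinearMap =
        Coalgebra.counit (R := k) (A := SOq3 q) := LinearMap.ext (counit_piSO q)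
    intro i
    apply (TensorProduct.rid k _).injective
    rw [map_zero]
    cases i
    · exact (coord_tangentSO_zero q _).symm.trans ((mem_calculusSO_iff q ρ).1 hρ 0)
    · refine Eq.trans ?_ ((coord_counit (ρ : SOq3 q ⊗[k] SOq3 q)).trans ρ.2)
      rw [coord_eq, ← h0, LinearMap.lTensor_comp, LinearMap.comp_apply,
        ← canonicalMap_pushCoaction]
      rfl

theorem rid_lTensor_invCoord_tildeN
    (hM : idealA q ≤ augmentation k k[T;T⁻¹])
    (h : ∀ ρ ∈ calculusSO q, tilde (monopoleCoaction q) ρ ∈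
      LinearMap.range ((idealA q).subtype.lTensor (SOq3 q))) (x : Forms (calculusSO q)) :
    TensorProduct.rid k _ ((invCoord q).lTensor _ (tildeN hM h x)) = formSO q 0 x := by
  obtain ⟨ρ, rfl⟩ := (calculusSO q).mkQ_surjective x
  refine Eq.trans ?_ (coord_tangentSO_zero q (ρ : SOq3 q ⊗[k] SOq3 q)).symm
  change TensorProduct.rid k _ ((invCoord q).lTensor _ ((piA (idealA q)).lTensor _
    (tilde (monopoleCoaction q) ρ))) = _
  have h1 : invCoord q ∘ₗ piA (idealA q) = fibreTangent q := LinearMap.ext (invCoord_piA q)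
  rw [← LinearMap.comp_apply, ← LinearMap.lTensor_comp, h1]
  rfl

theorem rid_lTensor_invCoord_injective :
    Function.Injective fun x : SOq3 q ⊗[k] InvForms (idealA q) =>
      TensorProduct.rid k _ ((invCoord q).lTensor _ x) :=
  (TensorProduct.rid k _).injective.comp
    (Module.Flat.lTensor_preserves_injective_linearMap _ (invCoord_injective q))

theorem invOp_tangentSO_zero {b : SOq3 q} (hb : monopoleCoaction q b = b ⊗ₜ 1) :
    invOp (tangentSO q 0) b = 0 := by
  have h := coord_tangentSO_zero q (1 ⊗ₜ b)
  rw [coord_tmul, canonicalMap_tmul, one_mul, one_smul, hb, LinearMap.lTensor_tmul,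
    fibreTangent_one] at h
  simpa using h

theorem genMul_coinvariant {i j : Gen} (h : (i = .a ∧ j = .b) ∨ (i = .c ∧ j = .d)) :
    monopoleCoaction q (genMul q i j) = genMul q i j ⊗ₜ 1 := by
  have inj := TensorProduct.map_injective_of_flat_flat (SOq3 q).val.toLinearMap
    (sqIncl (k := k)).toLinearMap Subtype.val_injective sqIncl_injective
  apply inj
  have h1 : TensorProduct.map (SOq3 q).val.toLinearMap (sqIncl (k := k)).toLinearMap
      (monopoleCoaction q (genMul q i j)) =
      Algebra.TensorProduct.map (.id k (SUq2 q)) (piSU q)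
        (suComul q (gen q i * gen q j)) := by
    rw [← coe_genMul, ← su_comul_apply, comul_coe, monopoleCoaction_eq, pushCoaction_apply]
    generalize Coalgebra.comul (R := k) (genMul q i j) = t
    induction t with
    | zero => simp
    | add a b ha hb => simp only [map_add, ha, hb]
    | tmul a b => simp [sqIncl_piSO]
  have hT : (T 1 * T (-1) : k[T;T⁻¹]) = 1 := by rw [← T_add]; rfl
  rw [h1]
  obtain ⟨rfl, rfl⟩ | ⟨rfl, rfl⟩ := h <;>
    simp [suComul, genImage, piSU_gen, coe_genMul, hT]

theorem tangent_genMul (m : Fin 3) (i j : Gen) : tangent q m (genMul q i j) =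
    genImage 1 0 0 1 i * tangent q m (gen q j) +
      tangent q m (gen q i) * tangentChar q m (gen q j) := by
  rw [coe_genMul, tangent_isSkew q m (gen q i), counit_gen]

/-- Horizontal forms are those whose vertical coordinate vanishes: the forms dual to `f₁` and `f₂`
are, up to scalars, the Maurer–Cartan forms of the coinvariants `αβ` and `γδ`. -/
theorem mem_horizontal_iff (x : Forms (calculusSO q)) :
    x ∈ horizontal (monopoleCoaction q) (calculusSO q) ↔ formSO q 0 x = 0 := by
  constructor
  · intro hx
    refine (Submodule.span_le (p := LinearMap.ker (formSO q 0))).2 ?_ hx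
    rintro _ ⟨b, v, hb, rfl⟩
    rw [SetLike.mem_coe, LinearMap.mem_ker, formSO, formCoord_mk,
      (tangentSO_isSkew q 0).coord_formMul]
    have h1 : coord (tangentSO q 0) (univD k (SOq3 q) b : SOq3 q ⊗[k] SOq3 q) = 0 := by
      refine (coord_formOf (tangentSO_isSkew q 0).one _).trans ?_
      rw [TensorProduct.mk_apply, coord_tmul, invOp_tangentSO_zero q hb, mul_zero]
    rw [h1, zero_mul]
  · intro hx
    have hq : (q : k) ≠ 0 := q.ne_zero
    have hab := maurerCartan_mem_horizontal (π := piSO q) (calculusSO q)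
      (genMul_coinvariant q (.inl ⟨rfl, rfl⟩))
    have hcd := maurerCartan_mem_horizontal (π := piSO q) (calculusSO q)
      (genMul_coinvariant q (.inr ⟨rfl, rfl⟩))
    have h : x = formSO q 1 x • maurerCartan (calculusSO q) (genMul q .a .b) +
        (formSO q 2 x * algebraMap k _ ((q : k)⁻¹)) •
          maurerCartan (calculusSO q) (genMul q .c .d) := by
      apply formSO_ext
      intro i
      rw [map_add, map_smul, map_smul, formSO_maurerCartan, formSO_maurerCartan, tangent_genMul,
        tangent_genMul, smul_eq_mul, smul_eq_mul, mul_assoc, ← map_mul, tangent_gen, tangent_gen,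
        tangent_gen, tangent_gen, tangentChar_gen, tangentChar_gen]
      fin_cases i <;> simp [genImage, hx, hq]
    rw [h]
    exact add_mem (Submodule.smul_mem _ _ hab) (Submodule.smul_mem _ _ hcd)

/-- The data of the `q`-monopole form a quantum principal bundle. -/
theorem isQuantumPrincipalBundle : IsQuantumPrincipalBundle (monopoleCoaction q) (calculusSO q)
    (idealA q) where
  coassoc := pushCoaction_coassoc _ (comul_piSO q)
  counit := pushCoaction_counit _ (counit_piSO q)
  mul_mem ρ hρ c := by
    rw [mem_calculusSO_iff] at hρ ⊢
    intro i
    rw [(tangentSO_isSkew q i).coord_formMul, hρ, zero_mul]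
  bicovariant := isBicovariantIdeal_idealA q
  free := canonicalMap_pushCoaction_surjective _ (piSO_surjective q)
  covariant := coactUniv_mem (π := piSO q) (tangentSO q) (fun i => T (![0, -1, 1] i))
    (mem_calculusSO_iff q) (fun i => (tangentSO_isSkew q i).one) (homogAt_tangentSO q)
  fundamental := tilde_mem q
  exact := by
    ext x
    rw [mem_horizontal_iff, LinearMap.mem_ker,
      ← rid_lTensor_invCoord_tildeN q (isBicovariantIdeal_idealA q).le_augmentation (tilde_mem q),
      ← (rid_lTensor_invCoord_injective q).eq_iff]
    simp

/-- The left-invariant vertical form `ω¹`, as a form on `SO_q(3)`: a multiple of the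
Maurer–Cartan form of `α²`, with `f₀(α²) = 1 + q⁻²`. If `q² = -1` it has the junk value `0`. -/
def omegaSO : Forms (calculusSO q) :=
  algebraMap k (SOq3 q) (1 + ((q : k)⁻¹) ^ 2)⁻¹ • maurerCartan (calculusSO q) (genMul q .a .a)

theorem one_add_inv_sq_ne_zero (hq : (q : k) ^ 2 ≠ -1) : 1 + ((q : k)⁻¹) ^ 2 ≠ 0 := by
  have h0 : (q : k) ≠ 0 := q.ne_zero
  intro h
  apply hq
  field_simp at h
  linear_combination h

theorem formSO_omegaSO (hq : (q : k) ^ 2 ≠ -1) (i : Fin 3) :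
    formSO q i (omegaSO q) = (![1, 0, 0] : Fin 3 → SOq3 q) i := by
  have h := one_add_inv_sq_ne_zero q hq
  rw [omegaSO, map_smul, formSO_maurerCartan, smul_eq_mul, ← map_mul, tangent_genMul, tangent_gen,
    tangentChar_gen]
  fin_cases i
  · simp only [Fin.zero_eta, Matrix.cons_val, genImage, one_mul]
    rw [inv_mul_cancel₀ h, map_one]
  · simp [genImage]
  · simp [genImage]

/-- The monopole connection 1-form. -/
def monopoleForm : k[T;T⁻¹] →ₗ[k] Forms (calculusSO q) :=
  (LinearMap.toSpanSingleton k (Forms (calculusSO q)) (omegaSO q)) ∘ₗ fibreTangent q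

theorem monopoleForm_apply (f : k[T;T⁻¹]) :
    monopoleForm q f = algebraMap k (SOq3 q) (fibreTangent q f) • omegaSO q := by
  rw [algebraMap_smul]
  rfl

theorem formSO_monopoleForm (hq : (q : k) ^ 2 ≠ -1) (f : k[T;T⁻¹]) (i : Fin 3) :
    formSO q i (monopoleForm q f) =
      (![algebraMap k (SOq3 q) (fibreTangent q f), 0, 0] : Fin 3 → SOq3 q) i := by
  rw [monopoleForm_apply, map_smul, formSO_omegaSO q hq]
  fin_cases i <;> simp

end Bundle

section Connection

open LaurentPolynomial

variable {k : Type*} [Field k] (q : kˣ)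

/-- The connection `ρ ↦ F₀(ρ) ω¹`, with `F₀` the vertical coordinate. -/
def monopoleProj : Forms (calculusSO q) →ₗ[SOq3 q] Forms (calculusSO q) :=
  (LinearMap.toSpanSingleton (SOq3 q) _ (omegaSO q)) ∘ₗ formSO q 0

theorem isConnection_monopoleProj (hq : (q : k) ^ 2 ≠ -1) :
    IsConnection (isQuantumPrincipalBundle q) (monopoleProj q) := by
  refine isConnection_of_coord (π := piSO q) (isQuantumPrincipalBundle q) (tangentSO q)
    (fun i => T (![0, -1, 1] i)) (mem_calculusSO_iff q) (fun i => (tangentSO_isSkew q i).one)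
    (homogAt_tangentSO q) (formSO q) (fun _ => rfl) 0 (mem_horizontal_iff q) (omegaSO q)
    (formSO_omegaSO q hq 0) fun i hi => (formSO_omegaSO q hq i).trans ?_
  fin_cases i
  · exact absurd rfl hi
  · rfl
  · rfl

/-- The splitting of the map `Γ_P → P ⊗ ker ε / M_A` given by `ω¹`. -/
def monopoleSplit : SOq3 q ⊗[k] InvForms (idealA q) →ₗ[SOq3 q] Forms (calculusSO q) :=
  (LinearMap.toSpanSingleton (SOq3 q) _ (omegaSO q)) ∘ₗ
    (TensorProduct.AlgebraTensorModule.rid k (SOq3 q) (SOq3 q)).toLinearMap ∘ₗ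
    (invCoord q).baseChange (SOq3 q)

theorem monopoleSplit_apply (x : SOq3 q ⊗[k] InvForms (idealA q)) : monopoleSplit q x =
    TensorProduct.rid k (SOq3 q) ((invCoord q).lTensor (SOq3 q) x) • omegaSO q := rfl

theorem isConnectionForm_monopoleForm (hq : (q : k) ^ 2 ≠ -1) :
    IsConnectionForm (isQuantumPrincipalBundle q) (monopoleForm q) := by
  refine ⟨monopoleProj q, monopoleSplit q, isConnection_monopoleProj q hq,
    LinearMap.ext fun x => ?_, LinearMap.ext fun x => ?_, fun a => ?_⟩
  · apply rid_lTensor_invCoord_injective q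
    refine (rid_lTensor_invCoord_tildeN q (isBicovariantIdeal_idealA q).le_augmentation
      (tilde_mem q) (monopoleSplit q x)).trans ?_
    rw [monopoleSplit_apply, map_smul, formSO_omegaSO q hq]
    exact mul_one _
  · exact congrArg (· • omegaSO q) 
      (rid_lTensor_invCoord_tildeN q (isBicovariantIdeal_idealA q).le_augmentation (tilde_mem q) x)
  · rw [monopoleSplit_apply, LinearMap.lTensor_tmul, invCoord_piA, monopoleForm_apply,
      TensorProduct.rid_tmul, Algebra.algebraMap_eq_smul_one]

end Connection

/-! ### The canonical map -/

section Canonical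

open LaurentPolynomial

variable {k : Type*} [Field k] (q : kˣ)

/-- The reduction of elements of `P₀` modulo `J ^ n`. -/
def locTrunc (n : ℕ) : Loc q →ₐ[k] Trunc q n :=
  (Pi.evalAlgHom k (Trunc q) n).comp ((Completion q).val.comp (Loc q).val)

theorem mk_mul_locTrunc_fibreUnit (n : ℕ) :
    Ideal.Quotient.mk (kerPi q ^ n) (gen q .d) * locTrunc q n (fibreUnit q) =
      Ideal.Quotient.mk (kerPi q ^ n) (gen q .a) := by
  have h : (deltaUnit q : Completion q) * ↑((deltaUnit q)⁻¹ * alphaUnit q) = alphaUnit q := by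
    rw [← Units.val_mul, mul_inv_cancel_left]
  exact congrArg (fun x : Completion q => x.1 n) h

theorem mk_mul_locTrunc_fibreUnit_inv (n : ℕ) :
    Ideal.Quotient.mk (kerPi q ^ n) (gen q .a) *
        locTrunc q n ((fibreUnit q)⁻¹ : (Loc q)ˣ) =
      Ideal.Quotient.mk (kerPi q ^ n) (gen q .d) := by
  have h : (alphaUnit q : Completion q) * ↑((alphaUnit q)⁻¹ * deltaUnit q) = deltaUnit q := by
    rw [← Units.val_mul, mul_inv_cancel_left]
  exact congrArg (fun x : Completion q => x.1 n) h

/-- An algebra map that kills `J ^ n` takes approximations of `i(f)` modulo `J ^ n` to `f(w)`,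
where `w` is the value of `δ⁻¹α`. -/
theorem apply_eq_laurentLift {B : Type*} [Ring B] [Algebra k B] (φ : SUq2 q →ₐ[k] B) (n : ℕ)
    (hφ : ∀ x ∈ kerPi q ^ n, φ x = 0) (w : Bˣ) (hw : φ (gen q .d) * w = φ (gen q .a))
    {u : SUq2 q} {f : k[T;T⁻¹]}
    (hu : Ideal.Quotient.mk (kerPi q ^ n) u = (iMap q f : Completion q).1 n) :
    φ u = laurentLift w f := by
  let Φ : Trunc q n →ₐ[k] B := Ideal.Quotient.liftₐ (kerPi q ^ n) φ hφ
  have hΦ : ∀ x, Φ (Ideal.Quotient.mk _ x) = φ x := fun x => rfl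
  have key : (Φ.comp (locTrunc q n)).comp (iMap q) = laurentLift w := by
    apply laurent_algHom_ext
    rw [AlgHom.comp_apply, AlgHom.comp_apply, iMap, laurentLift_T, laurentLift_T, zpow_one,
      zpow_one]
    have h1 := congrArg Φ (mk_mul_locTrunc_fibreUnit q n)
    rw [map_mul, hΦ, hΦ, ← hw] at h1
    have h2 : IsUnit (φ (gen q .d)) := by
      rw [← hΦ]
      exact (isUnit_trunc q n).2.map Φ
    exact h2.mul_left_cancel h1
  rw [← hΦ, hu, ← key]
  rfl

theorem counit_eq_zero_of_mem_kerPi {x : SUq2 q} (hx : x ∈ kerPi q) :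
    Coalgebra.counit (R := k) x = 0 := by
  rw [← counit_piSU, (RingHom.mem_ker).1 hx]
  exact map_zero _

theorem tangentChar_eq_zero_of_mem_kerPi (i : Fin 3) {x : SUq2 q} (hx : x ∈ kerPi q) :
    tangentChar q i x = 0 := by
  have h : tangentChar q i = (laurentLift (![q⁻¹ ^ 2, q⁻¹, q⁻¹] i)).comp (piSU q) := by
    apply su_hom_ext
    intro j
    cases j <;> simp [tangentChar, genImage, piSU_gen, laurentLift_T]
  rw [h, AlgHom.comp_apply, show piSU q x = 0 from hx, map_zero]

/-- The representations defining the tangent functionals kill `J²`. -/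
theorem tangentRep_eq_zero_of_mem (i : Fin 3) {x : SUq2 q} (hx : x ∈ kerPi q ^ 2) :
    tangentRep q i x = 0 := by
  rw [Submodule.pow_succ (n := 1), Submodule.pow_one] at hx
  induction hx using Submodule.mul_induction_on' with
  | mem_mul_mem x hx y hy =>
    have h := counit_eq_zero_of_mem_kerPi q hx
    have h' := tangentChar_eq_zero_of_mem_kerPi q i hy
    rw [tangentRep_apply, tangent_isSkew q i x, Bialgebra.counit_mul, map_mul, h, h']
    ext m n
    fin_cases m <;> fin_cases n <;> simp
  | add x _ y _ hx hy => rw [map_add, hx, hy, add_zero]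

theorem tangent_eq_of_approx (i : Fin 3) {u : SUq2 q} {f : k[T;T⁻¹]}
    (hu : Ideal.Quotient.mk (kerPi q ^ 2) u = (iMap q f : Completion q).1 2) :
    tangent q i u = (![fibreTangent q f, 0, 0] : Fin 3 → k) i := by
  have h := apply_eq_laurentLift q (tangentRep q i) 2 (fun x hx => tangentRep_eq_zero_of_mem q i hx)
    (alphaMatrix q i ^ 2) (by
      rw [Units.val_pow_eq_pow_val, pow_two, ← mul_assoc]
      exact (congrArg (· * _) (alphaMatrix q i).inv_mul).trans (one_mul _)) hu
  rw [tangent_apply, h]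
  by_cases hi : i = 0
  · subst hi
    rfl
  -- For `i ≠ 0` the matrices of `α` and `δ` are diagonal.
  · have hd : laurentLift (alphaMatrix q i ^ 2) = (Matrix.diagonalAlgHom k).comp
        (laurentLift (MulEquiv.piUnits.symm ![1, q⁻¹ ^ 2])) := by
      apply laurent_algHom_ext
      rw [AlgHom.comp_apply, laurentLift_T, laurentLift_T, zpow_one, zpow_one,
        Units.val_pow_eq_pow_val, pow_two]
      ext m n
      fin_cases i
      · exact absurd rfl hi
      all_goals
        fin_cases m <;> fin_cases n <;>
          simp [alphaMatrix, tangentRep, genImage, Matrix.mul_apply, Fin.sum_univ_two, pow_two]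
    rw [hd]
    fin_cases i
    · exact absurd rfl hi
    · simp
    · simp

theorem isCanonicalMap_monopoleForm (hq : (q : k) ^ 2 ≠ -1) :
    IsCanonicalMap q (monopoleForm q) := by
  intro f
  refine ⟨2, fun u hu => formSO_ext q fun i => ?_⟩
  rw [formSO_maurerCartan, formSO_monopoleForm q hq, tangent_eq_of_approx q i hu]
  fin_cases i <;> simp

/-- Approximate left division by a geometric series: if `p r = 1 - N` with `N ∈ J` and
`p x = N p`, then `(Σ x ^ j) r²` approximates `p⁻¹ r`. -/
theorem exists_approx_div {p r x N : SUq2 q} (hx : x ∈ SOq3 q) (hr : r * r ∈ SOq3 q)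
    (hN : N ∈ kerPi q) (hpx : p * x = N * p) (hpr : p * r = 1 - N) (n : ℕ) :
    ∃ z ∈ SOq3 q, Ideal.Quotient.mk (kerPi q ^ n) (p * z) = Ideal.Quotient.mk _ r := by
  refine ⟨(∑ j ∈ Finset.range n, x ^ j) * (r * r), mul_mem (sum_mem fun j _ => pow_mem hx j) hr, ?_⟩
  have h1 : p * ∑ j ∈ Finset.range n, x ^ j = (∑ j ∈ Finset.range n, N ^ j) * p := by
    rw [Finset.mul_sum, Finset.sum_mul]
    refine Finset.sum_congr rfl fun j _ => ?_
    exact (SemiconjBy.pow_right (show SemiconjBy p x N from hpx) j).eq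
  have h2 : p * ((∑ j ∈ Finset.range n, x ^ j) * (r * r)) = r - N ^ n * r := by
    rw [← mul_assoc, h1, mul_assoc, ← mul_assoc p, hpr, ← mul_assoc, geom_sum_mul_neg, sub_mul,
      one_mul]
  rw [h2, map_sub, sub_eq_self, Ideal.Quotient.eq_zero_iff_mem]
  exact Ideal.mul_mem_right _ _ (Ideal.pow_mem_pow hN n)

/-- Elements of `SO_q(3)` are dense in `P₀`. -/
theorem exists_approx (x : Loc q) (n : ℕ) :
    ∃ u : SOq3 q, Ideal.Quotient.mk (kerPi q ^ n) (u : SUq2 q) = (x : Completion q).1 n := by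
  let S : Subalgebra k (Trunc q n) :=
    ((Ideal.Quotient.mkₐ k (kerPi q ^ n)).comp (SOq3 q).val).range
  have hq : (q : k) ≠ 0 := q.ne_zero
  obtain ⟨ab, ac, -, bc, bd, cd, -⟩ := gen_relations q
  have hbc : ∀ r : k, r • (gen q .b * gen q .c) ∈ SOq3 q := fun r =>
    Subalgebra.smul_mem _ (genMul q .b .c).2 r
  suffices h : Loc q ≤ S.comap ((Pi.evalAlgHom k (Trunc q) n).comp (Completion q).val) from h x.2
  refine Algebra.adjoin_le ?_
  rintro y (⟨u, rfl⟩ | rfl | rfl)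
  · exact ⟨u, rfl⟩
  -- `δα = 1 + q⁻¹βγ` and `δ(-qβγ) = (-q⁻¹βγ)δ`.
  · obtain ⟨z, hz, h⟩ := exists_approx_div q (p := gen q .d) (r := gen q .a)
      (hbc (-(q : k))) (genMul q .a .a).2 (bc_mem_kerPi q (-(q : k)⁻¹))
      (by
        rw [mul_smul_comm, smul_mul_assoc, mul_assoc, cd, mul_smul_comm, ← mul_assoc (gen q .b), bd,
          smul_mul_assoc, smul_smul, smul_smul, mul_assoc (gen q .d)]
        congr 1
        field_simp)
      (by rw [da_eq, neg_smul, sub_neg_eq_add]) n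
    refine ⟨⟨z, hz⟩, (isUnit_trunc q n).2.mul_left_cancel ?_⟩
    refine Eq.trans ?_ (mk_mul_locTrunc_fibreUnit q n).symm
    rw [← h, map_mul]
    rfl
  -- `αδ = 1 + qβγ` and `α(-q⁻¹βγ) = (-qβγ)α`.
  · obtain ⟨z, hz, h⟩ := exists_approx_div q (p := gen q .a) (r := gen q .d)
      (hbc (-(q : k)⁻¹)) (genMul q .d .d).2 (bc_mem_kerPi q (-(q : k)))
      (by
        rw [mul_smul_comm, smul_mul_assoc, ← mul_assoc, ab, smul_mul_assoc, mul_assoc, ac,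
          mul_smul_comm, smul_smul, smul_smul, ← mul_assoc]
        congr 1
        field_simp)
      (by rw [ad_eq, neg_smul, sub_neg_eq_add]) n
    refine ⟨⟨z, hz⟩, (isUnit_trunc q n).1.mul_left_cancel ?_⟩
    refine Eq.trans ?_ (mk_mul_locTrunc_fibreUnit_inv q n).symm
    rw [← h, map_mul]
    rfl

theorem IsCanonicalMap.unique {ω ω' : k[T;T⁻¹] →ₗ[k] Forms (calculusSO q)}
    (h : IsCanonicalMap q ω) (h' : IsCanonicalMap q ω') : ω' = ω := by
  refine LinearMap.ext fun f => ?_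
  obtain ⟨m, hm⟩ := h f
  obtain ⟨n, hn⟩ := h' f
  obtain ⟨u, hu⟩ := exists_approx q (iMap q f) (max m n)
  have hres : ∀ l, l ≤ max m n → Ideal.Quotient.mk (kerPi q ^ l) (u : SUq2 q) =
      (iMap q f : Completion q).1 l := by
    intro l hl
    rw [← (iMap q f : Completion q).2 l _ hl, ← hu]
    rfl
  rw [← hm u (hres m (le_max_left _ _)), ← hn u (hres n (le_max_right _ _))]

theorem formSU_omega1 (i : Fin 3) :
    formSU q i (omega1 q) = (![1, 0, 0] : Fin 3 → SUq2 q) i := by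
  have hdiff : ∀ j, formSU q i (diff (calculusSU q) (gen q j)) = invOp (tangent q i) (gen q j) :=
    fun j => formCoord_diff (tangent_isSkew q i).one _ _
  have hq : (q : k) ≠ 0 := q.ne_zero
  obtain ⟨-, -, -, -, bd, -, -⟩ := gen_relations q
  rw [omega1, map_sub, map_smul, LinearMap.map_smul_of_tower, map_smul, hdiff, hdiff]
  simp only [invOp, LinearMap.comp_apply, su_comul_apply, suComul, suLift_gen, genImage, map_add,
    LinearMap.lTensor_tmul, LinearEquiv.coe_coe, TensorProduct.rid_tmul, tangent_gen]
  fin_cases i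
  · simp [genImage, da_eq]
  · simp [genImage]
  · simp [genImage, bd, smul_smul, hq]

end Canonical

end QuantumBundle

end

theorem proposition5p13 {k : Type*} [Field k] (h2 : (2 : k) ≠ 0) (q : kˣ)
    (hq : (q : k) ^ 2 ≠ -1) :
    ∃ ω : LaurentPolynomial k →ₗ[k] QuantumBundle.Forms (QuantumBundle.calculusSO q),
      QuantumBundle.IsCanonicalMap q ω ∧
      (∀ ω', QuantumBundle.IsCanonicalMap q ω' → ω' = ω) ∧
      (∃ h : QuantumBundle.IsQuantumPrincipalBundle (QuantumBundle.monopoleCoaction q)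
          (QuantumBundle.calculusSO q) (QuantumBundle.idealA q),
        QuantumBundle.IsConnectionForm h ω) ∧
      ∀ f : LaurentPolynomial k,
        QuantumBundle.formsMap (QuantumBundle.SOq3 q).val (QuantumBundle.calculusSU q) (ω f) =
          (QuantumBundle.qNumber ((q : k) ^ (-2 : ℤ)) 2 *
            QuantumBundle.evalOne (QuantumBundle.jackson ((q : k) ^ (-4 : ℤ)) f)) •
            QuantumBundle.omega1 q := by
  refine ⟨QuantumBundle.monopoleForm q, QuantumBundle.isCanonicalMap_monopoleForm q hq,
    fun ω' h' => (QuantumBundle.isCanonicalMap_monopoleForm q hq).unique q h',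
    ⟨QuantumBundle.isQuantumPrincipalBundle q,
      QuantumBundle.isConnectionForm_monopoleForm q hq⟩, fun f => ?_⟩
  rw [← QuantumBundle.fibreTangent_eq_jackson]
  refine QuantumBundle.formSU_ext q fun i => ?_
  rw [QuantumBundle.formSU_formsMap, QuantumBundle.formSO_monopoleForm q hq,
    LinearMap.map_smul_of_tower, QuantumBundle.formSU_omega1]
  fin_cases i <;> simp [Algebra.algebraMap_eq_smul_one]
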